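/- Let $n\ge 0$, let $U\subset\mathbb R^n$ be an open set, let $L\in C^2(\mathbb R^n;\mathbb R)$ and $\Lambda>0$; inequalities between symmetric matrices are in the sense of quadratic forms, and $\nabla u$ is the weak gradient. A weak solution on $U$ of $\nabla\cdot F=0$ means $F\in L^1_{\mathrm{loc}}(U)$ and $\int_U F\cdot\nabla w\,dx=0$ for all $w\in C_c^\infty(U)$. A set $\mathcal A\subset H^1(U)$ is called admissible if $v+w\in\mathcal A$ for all $v\in\mathcal A$ and $w\in C^\infty_c(U)$ (for example $\mathcal A=H^1(U)$, or $\mathcal A=g+H^1_0(U)$ with $g\in H^1(U)$). For $v\in H^1(U)$ let $$\mathcal E(v)=\int_U L(\nabla v)\,dx\in[-\infty,+\infty],$$ with $\mathcal E(v)=+\infty$ whenever the positive part of $L(\nabla v)$ is not integrable. A minimiser of $\mathcal E$ in $\mathcal A$ is a $u\in\mathcal A$ such that $L(\nabla u)$ is integrable on $U$ and $\mathcal E(u)\le\mathcal E(v)$ for all $v\in\mathcal A$. (i) If $\nabla^2L\le\Lambda$ on $\mathbb R^n$, then, for every admissible $\mathcal A$, every minimiser $u$ of $\mathcal E$ in $\mathcal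 A$ is a weak solution of the Euler–Lagrange equation $\nabla\cdot\big(\nabla L(\nabla u)\big)=0$ on $U$. (ii) If $\Lambda^{-1}\le\nabla^2L\le\Lambda$ on $\mathbb R^n$, let $u\in H^1(U)$ be a weak solution of $\nabla\cdot\big(\nabla L(\nabla u)\big)=0$ on $U$, and let $V$ be an open set whose closure is compact and contained in $U$. Then $u\in H^2(V)$, and for each $i=1,\dots,n$ the function $f=\partial_{x_i}u$ belongs to $H^1(V)$ and is a weak solution of $\nabla\cdot\big(\nabla^2L(\nabla u)\,\nabla f\big)=0$ on $V$. -/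

import Mathlib

open MeasureTheory TopologicalSpace
open scoped ENNReal Gradient Distributions

namespace EllipticReg

/-- The Euclidean space `ℝⁿ`. -/
abbrev Eu (n : ℕ) : Type := EuclideanSpace ℝ (Fin n)

section

variable {n : ℕ}

/-- `G` is a weak (distributional) gradient of `u` on the open set `U`: both are locally integrable
on `U`, and `∫_U u ∂ᵢφ = - ∫_U Gᵢ φ` for every `φ ∈ C_c^∞(U)` and every `i`. -/
structure IsWeakGrad (U : Opens (Eu n)) (u : Eu n → ℝ) (G : Eu n → Eu n) : Prop where
  locInt : LocallyIntegrableOn u U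
  locInt_grad : LocallyIntegrableOn G U
  integral_eq : ∀ (φ : 𝓓(U, ℝ)) (i : Fin n),
    ∫ x in U, u x * (∇ φ x) i = - ∫ x in U, G x i * φ x

open Classical in
/-- The weak gradient `∇u` of `u` on `U`, well defined up to null sets (and set to `0` when `u` has
no weak gradient on `U`). -/
noncomputable def weakGrad (U : Opens (Eu n)) (u : Eu n → ℝ) : Eu n → Eu n :=
  if h : ∃ G, IsWeakGrad U u G then h.choose else 0

/-- Weak gradients are unique up to null sets. -/
theorem IsWeakGrad.ae_eq {U : Opens (Eu n)} {u : Eu n → ℝ} {G H : Eu n → Eu n}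
    (hG : IsWeakGrad U u G) (hH : IsWeakGrad U u H) : G =ᵐ[volume.restrict U] H := by
  have key : ∀ i : Fin n, ∀ᵐ x ∂volume, x ∈ (U : Set (Eu n)) → G x i - H x i = 0 := by
    intro i
    have loc : ∀ {F : Eu n → Eu n}, LocallyIntegrableOn F U →
        LocallyIntegrableOn (fun x => F x i) U := fun {F} hF x hx => by
      obtain ⟨s, hs, h⟩ := hF x hx
      exact ⟨s, hs, (EuclideanSpace.proj (𝕜 := ℝ) i).integrable_comp h⟩
    refine U.isOpen.ae_eq_zero_of_integral_contDiff_smul_eq_zero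
      ((loc hG.locInt_grad).sub (loc hH.locInt_grad)) ?_
    intro g hg hgc hgs
    let φ : 𝓓(U, ℝ) := ⟨g, hg, hgc, hgs⟩
    have mul : ∀ {F : Eu n → Eu n}, LocallyIntegrableOn F U →
        Integrable (fun x => F x i * g x) (volume.restrict U) := fun {F} hF => by
      have h1 : IntegrableOn (fun x => g x • F x i) (tsupport g) :=
        ((loc hF).integrableOn_compact_subset hgs hgc).continuousOn_smul
          hg.continuous.continuousOn hgc
      have h2 : Integrable (fun x => g x • F x i) := by
        refine (integrableOn_iff_integrable_of_support_subset ?_).1 h1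
        intro x hx
        refine subset_tsupport g fun h => hx ?_
        simp [h]
      simpa only [smul_eq_mul, mul_comm] using h2.restrict (s := (U : Set (Eu n)))
    have e : ∫ x in U, (G x i * g x - H x i * g x) = 0 := by
      have h1 : -∫ x in U, G x i * g x = -∫ x in U, H x i * g x :=
        (hG.integral_eq φ i).symm.trans (hH.integral_eq φ i)
      rw [integral_sub (mul hG.locInt_grad) (mul hH.locInt_grad)]
      linarith
    rw [← e, ← setIntegral_eq_integral_of_forall_compl_eq_zero (s := (U : Set (Eu n)))]
    · congr 1
      ext x
      simp only [smul_eq_mul]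
      ring
    · intro x hx
      rw [image_eq_zero_of_notMem_tsupport fun h => hx (hgs h), zero_smul]
  rw [Filter.EventuallyEq, ae_restrict_iff' U.isOpen.measurableSet]
  filter_upwards [ae_all_iff.2 key] with x hx hxU
  ext i
  exact sub_eq_zero.1 (hx i hxU)

theorem IsWeakGrad.weakGrad_ae_eq {U : Opens (Eu n)} {u : Eu n → ℝ} {G : Eu n → Eu n}
    (hG : IsWeakGrad U u G) : weakGrad U u =ᵐ[volume.restrict U] G := by
  have h : ∃ G, IsWeakGrad U u G := ⟨G, hG⟩
  have h' : weakGrad U u = h.choose := dif_pos h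
  rw [h']
  exact h.choose_spec.ae_eq hG

/-- `u ∈ H¹(U)`: `u` is in `L²(U)` and has a weak gradient in `L²(U)`. -/
structure MemH1 (U : Opens (Eu n)) (u : Eu n → ℝ) : Prop where
  memLp : MemLp u 2 (volume.restrict U)
  exists_grad : ∃ G, IsWeakGrad U u G ∧ MemLp G 2 (volume.restrict U)

/-- `u ∈ H²(U)`: `u ∈ H¹(U)` and all its weak partial derivatives are in `H¹(U)`. -/
structure MemH2 (U : Opens (Eu n)) (u : Eu n → ℝ) : Prop where
  memH1 : MemH1 U u
  memH1_partial : ∀ i : Fin n, MemH1 U (fun x => weakGrad U u x i)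

/-- The Hessian `∇²L(p)`, as a linear operator on `ℝⁿ`. -/
noncomputable def hessian (L : Eu n → ℝ) (p : Eu n) : Eu n →L[ℝ] Eu n :=
  fderiv ℝ (∇ L) p

/-- `∇²L ≤ Λ` on `ℝⁿ`, in the sense of quadratic forms. -/
def HessianLE (L : Eu n → ℝ) (Λ : ℝ) : Prop :=
  ∀ p ξ : Eu n, inner ℝ (hessian L p ξ) ξ ≤ Λ * ‖ξ‖ ^ 2

/-- `lam ≤ ∇²L` on `ℝⁿ`, in the sense of quadratic forms. -/
def HessianGE (L : Eu n → ℝ) (lam : ℝ) : Prop :=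
  ∀ p ξ : Eu n, lam * ‖ξ‖ ^ 2 ≤ inner ℝ (hessian L p ξ) ξ

/-- The energy `∫_U L(∇v)`, with values in `[-∞, +∞]`: the integral of the positive part of `L(∇v)`
minus the integral of its negative part, with value `+∞` as soon as the former is infinite. -/
noncomputable def energy (U : Opens (Eu n)) (L : Eu n → ℝ) (v : Eu n → ℝ) : EReal :=
  open Classical in
  if ∫⁻ x in U, ENNReal.ofReal (L (weakGrad U v x)) = ∞ then ⊤
  else ((∫⁻ x in U, ENNReal.ofReal (L (weakGrad U v x)) : ℝ≥0∞) : EReal)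
    - ((∫⁻ x in U, ENNReal.ofReal (-L (weakGrad U v x)) : ℝ≥0∞) : EReal)

/-- An admissible class for the variational problem on `U`: a set of `H¹(U)` functions stable under
the addition of test functions, which are the perturbations that do not affect boundary conditions.
Examples are `H¹(U)` itself and `g + H¹₀(U)`. -/
structure IsAdmissibleClass (U : Opens (Eu n)) (𝒜 : Set (Eu n → ℝ)) : Prop where
  memH1 : ∀ v ∈ 𝒜, MemH1 U v
  add_test : ∀ v ∈ 𝒜, ∀ w : 𝓓(U, ℝ), (fun x => v x + w x) ∈ 𝒜

/-- `u` is a minimiser, with finite energy, of `v ↦ ∫_U L(∇v)` over the class `𝒜`. -/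
structure IsMinimiser (U : Opens (Eu n)) (L : Eu n → ℝ) (𝒜 : Set (Eu n → ℝ))
    (u : Eu n → ℝ) : Prop where
  mem : u ∈ 𝒜
  finite_energy : IntegrableOn (fun x => L (weakGrad U u x)) U
  energy_le : ∀ v ∈ 𝒜, energy U L u ≤ energy U L v

/-- The vector field `F` satisfies `∇ · F = 0` in `𝓓'(U)`: it is locally integrable on `U` and
`∫_U F · ∇w = 0` for every `w ∈ C_c^∞(U)`. -/
structure WeakDivEqZero (U : Opens (Eu n)) (F : Eu n → Eu n) : Prop where
  locInt : LocallyIntegrableOn F U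
  integral_eq_zero : ∀ w : 𝓓(U, ℝ), ∫ x in U, inner ℝ (F x) (∇ w x) = 0

/-- `u ∈ H¹(U)` is a weak solution of the Euler–Lagrange equation `∇ · (∇L(∇u)) = 0` on `U`. -/
structure IsWeakSolEL (U : Opens (Eu n)) (L : Eu n → ℝ) (u : Eu n → ℝ) : Prop where
  memH1 : MemH1 U u
  weak : WeakDivEqZero U (fun x => ∇ L (weakGrad U u x))

/-- `f ∈ H¹(U)` is a weak solution of the linear equation `∇ · (A ∇f) = 0` on `U`. -/
structure IsWeakSolLinear (U : Opens (Eu n)) (A : Eu n → Eu n →L[ℝ] Eu n) (f : Eu n → ℝ) :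
    Prop where
  memH1 : MemH1 U f
  weak : WeakDivEqZero U (fun x => A x (weakGrad U f x))

end

end EllipticReg

/-! For (i), perturb the minimiser by `s • w`. The upper Hessian bound gives a one-sided Taylor
estimate (`HessianLE.le_taylor`), so the energy increases by at most `I s + (Λ/2) B s²`, where `I`
is the integral of `∇L(∇u) · ∇w` and `B` that of `‖∇w‖²`. Minimality makes this quadratic
nonnegative for every real `s`, which forces `I = 0`. The difficulty is integrability, since `L` has
no lower growth bound. The positive part of `L(∇u + ∇w)` is controlled by Taylor's estimate, and its
negative part by minimality itself (`IsMinimiser.integrableOn_add_gradient`). Perturbations that are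
linear near a compact set then bound each component of `∇L(∇u)` in `L¹` there
(`IsMinimiser.locallyIntegrableOn_gradient`).

For (ii), the method is Nirenberg's difference quotients. The two Hessian bounds make `∇L` strongly
monotone and Lipschitz. Subtracting the equation from its translate and testing with `η²` times the
difference of `u` gives an energy estimate (`caccioppoli`): the translation increment of `∇u` is
controlled in `L²`, where `η = 1`, by that of `u`, hence by a multiple of `|t|`. By duality such a
bound yields weak derivatives in `L²` (`exists_weakDeriv_of_translate_le`), so `∇u` is in `H¹(V)`.
The linear equation follows by testing the nonlinear one with `∂ᵢw` and moving `∂ᵢ` onto `∇L(∇u)`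
through the chain rule `HasWeakDeriv.comp`.

Cutoffs transfer everything to `ℝⁿ`, where mollification and translation are available. -/

namespace EllipticReg

open Filter Topology ContinuousLinearMap

/-! ### Mollification in `L²(ℝⁿ)`. -/

section Mollification

variable {n : ℕ} {F : Type*} [NormedAddCommGroup F]

theorem tendsto_eLpNorm_translate_sub {f : Eu n → F} (hf : MemLp f 2) :
    Tendsto (fun y : Eu n => eLpNorm (fun x => f (x - y) - f x) 2) (𝓝 0) (𝓝 0) := by
  let g : Eu n → C(Eu n, Eu n) := fun y => ⟨fun x => x - y, by fun_prop⟩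
  have hg : Continuous g :=
    (ContinuousMap.mk (fun a : Eu n × Eu n => a.2 - a.1) (by fun_prop)).curry.continuous
  have hgm : ∀ y, MeasurePreserving (g y) volume volume :=
    fun y => measurePreserving_sub_right volume y
  have hc : Continuous fun y => Lp.compMeasurePreserving (g y) (hgm y) (hf.toLp f) :=
    Continuous.compMeasurePreservingLp continuous_const hg hgm (by simp)
  have h0 : Lp.compMeasurePreserving (g 0) (hgm 0) (hf.toLp f) = hf.toLp f := by
    rw [Lp.toLp_compMeasurePreserving]
    congr 1
    ext x
    simp [g]
  have h1 := (hc.tendsto 0).edist (tendsto_const_nhds (x := hf.toLp f))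
  rw [h0, edist_self] at h1
  refine h1.congr fun y => ?_
  rw [Lp.toLp_compMeasurePreserving, Lp.edist_toLp_toLp]
  rfl

variable [NormedSpace ℝ F]

/-- The mollification of `f` by a normalised bump function. -/
noncomputable def moll (ρ : ContDiffBump (0 : Eu n)) (f : Eu n → F) : Eu n → F :=
  convolution (ρ.normed volume) f (lsmul ℝ ℝ) volume

theorem moll_sub_apply [CompleteSpace F] (ρ : ContDiffBump (0 : Eu n)) {f : Eu n → F}
    (hf : LocallyIntegrable f) (x : Eu n) :
    moll ρ f x - f x = ∫ y, ρ.normed volume y • (f (x - y) - f x) := by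
  have h1 : Integrable fun y => ρ.normed volume y • f (x - y) :=
    ρ.hasCompactSupport_normed.convolutionExists_left (lsmul ℝ ℝ) ρ.continuous_normed hf x
  have h2 : Integrable fun y => ρ.normed volume y • f x :=
    ρ.integrable_normed.smul_const _
  simp_rw [smul_sub]
  rw [integral_sub h1 h2, integral_smul_const, ρ.integral_normed, one_smul]
  rfl

/-- The error is an average of `f (· - y) - f` against the probability density `ρ`; Jensen's
inequality moves the square inside the average and Tonelli swaps the integrals. -/
theorem eLpNorm_moll_sub_le [CompleteSpace F] (ρ : ContDiffBump (0 : Eu n)) {f : Eu n → F}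
    (hf : MemLp f 2) {δ : ℝ≥0∞}
    (hδ : ∀ y ∈ Metric.ball (0 : Eu n) ρ.rOut, eLpNorm (fun x => f (x - y) - f x) 2 ≤ δ) :
    eLpNorm (fun x => moll ρ f x - f x) 2 ≤ δ := by
  have hloc : LocallyIntegrable f := hf.locallyIntegrable (by norm_num)
  set r : Eu n → ℝ≥0∞ := fun y => ‖ρ.normed volume y‖ₑ with hr
  have hrm : Measurable r := ρ.continuous_normed.measurable.enorm
  have hr1 : ∫⁻ y, r y = 1 := by
    have := ofReal_integral_norm_eq_lintegral_enorm (ρ.integrable_normed (μ := volume))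
    rw [← this]
    simp_rw [Real.norm_of_nonneg (ρ.nonneg_normed _), ρ.integral_normed, ENNReal.ofReal_one]
  have sq : ∀ h : Eu n → F, eLpNorm h 2 volume ^ 2 = ∫⁻ x, ‖h x‖ₑ ^ 2 := fun h => by
    have := eLpNorm_nnreal_pow_eq_lintegral (f := h) (μ := volume) (p := 2) (by norm_num)
    simpa using this
  have hk : AEStronglyMeasurable (fun p : Eu n × Eu n => f (p.1 - p.2) - f p.1)
      (volume.prod volume) :=
    (hf.1.comp_quasiMeasurePreserving
      (quasiMeasurePreserving_sub_of_right_invariant volume volume)).sub hf.1.comp_fst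
  have hpt : ∀ᵐ x, ‖moll ρ f x - f x‖ₑ ^ 2 ≤ ∫⁻ y, r y * ‖f (x - y) - f x‖ₑ ^ 2 := by
    filter_upwards [hk.prodMk_left] with x hx
    rw [moll_sub_apply ρ hloc]
    have h1 : ‖∫ y, ρ.normed volume y • (f (x - y) - f x)‖ₑ
        ≤ ∫⁻ y, r y * ‖f (x - y) - f x‖ₑ := by
      refine (enorm_integral_le_lintegral_enorm _).trans_eq ?_
      simp_rw [enorm_smul, hr]
    -- Jensen's inequality here is the comparison of the `L¹` and `L²` norms for the probability
    -- measure with density `r`.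
    have hrp : IsProbabilityMeasure (volume.withDensity r) := ⟨by
      rw [withDensity_apply _ .univ, setLIntegral_univ, hr1]⟩
    have hx' : AEStronglyMeasurable (fun y => f (x - y) - f x) (volume.withDensity r) :=
      hx.mono_ac (withDensity_absolutelyContinuous _ _)
    have h2 := eLpNorm_le_eLpNorm_of_exponent_le (p := 1) (q := 2) (by norm_num) hx'
    have h3 : eLpNorm (fun y => f (x - y) - f x) 2 (volume.withDensity r) ^ 2 =
        ∫⁻ y, r y * ‖f (x - y) - f x‖ₑ ^ 2 := by
      have := eLpNorm_nnreal_pow_eq_lintegral (f := fun y => f (x - y) - f x)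
        (μ := volume.withDensity r) (p := 2) (by norm_num)
      rw [lintegral_withDensity_eq_lintegral_mul₀ hrm.aemeasurable
        (hx.enorm.pow_const _)] at this
      simpa using this
    rw [eLpNorm_one_eq_lintegral_enorm, lintegral_withDensity_eq_lintegral_mul₀ hrm.aemeasurable
      hx.enorm] at h2
    rw [← h3]
    gcongr
    exact h1.trans h2
  have key : eLpNorm (fun x => moll ρ f x - f x) 2 volume ^ 2 ≤ δ ^ 2 := by
    rw [sq]
    calc ∫⁻ x, ‖moll ρ f x - f x‖ₑ ^ 2 ≤ ∫⁻ x, ∫⁻ y, r y * ‖f (x - y) - f x‖ₑ ^ 2 :=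
          lintegral_mono_ae hpt
      _ = ∫⁻ y, ∫⁻ x, r y * ‖f (x - y) - f x‖ₑ ^ 2 :=
          lintegral_lintegral_swap
            ((hrm.comp measurable_snd).aemeasurable.mul (hk.enorm.pow_const _))
      _ ≤ ∫⁻ y, r y * δ ^ 2 := by
          refine lintegral_mono fun y => ?_
          simp only
          rw [lintegral_const_mul' _ _ (by simp [hr]), ← sq]
          by_cases hy : y ∈ Metric.ball (0 : Eu n) ρ.rOut
          · gcongr
            exact hδ y hy
          · have : ρ.normed volume y = 0 := by
              rwa [← Function.notMem_support, ρ.support_normed_eq]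
            simp [hr, this]
      _ = δ ^ 2 := by rw [lintegral_mul_const _ hrm, hr1, one_mul]
  exact (ENNReal.pow_le_pow_left_iff two_ne_zero).1 key

theorem tendsto_eLpNorm_moll_sub [CompleteSpace F] {ρ : ℕ → ContDiffBump (0 : Eu n)}
    (hρ : Tendsto (fun k => (ρ k).rOut) atTop (𝓝 0)) {f : Eu n → F} (hf : MemLp f 2) :
    Tendsto (fun k => eLpNorm (fun x => moll (ρ k) f x - f x) 2) atTop (𝓝 0) := by
  rw [ENNReal.tendsto_nhds_zero]
  intro ε hε
  obtain ⟨d, hd, hd'⟩ := Metric.eventually_nhds_iff_ball.1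
    (ENNReal.tendsto_nhds_zero.1 (tendsto_eLpNorm_translate_sub hf) ε hε)
  filter_upwards [hρ.eventually_lt_const hd] with k hk
  exact eLpNorm_moll_sub_le _ hf fun y hy => hd' y (Metric.ball_subset_ball hk.le hy)

theorem contDiff_moll [CompleteSpace F] (ρ : ContDiffBump (0 : Eu n)) {f : Eu n → F}
    (hf : LocallyIntegrable f) : ContDiff ℝ (⊤ : ℕ∞) (moll ρ f) :=
  ρ.hasCompactSupport_normed.contDiff_convolution_left _ ρ.contDiff_normed hf

theorem memLp_moll [CompleteSpace F] (ρ : ContDiffBump (0 : Eu n)) {f : Eu n → F}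
    (hf : MemLp f 2) : MemLp (moll ρ f) 2 := by
  have hloc : LocallyIntegrable f := hf.locallyIntegrable (by norm_num)
  have h1 : MemLp (fun x => moll ρ f x - f x) 2 := by
    refine ⟨(contDiff_moll ρ hloc).continuous.aestronglyMeasurable.sub hf.1, ?_⟩
    refine lt_of_le_of_lt (eLpNorm_moll_sub_le ρ hf (δ := eLpNorm f 2 volume + eLpNorm f 2 volume)
      fun y _ => ?_) (ENNReal.add_lt_top.2 ⟨hf.2, hf.2⟩)
    have hm := measurePreserving_sub_right (volume : Measure (Eu n)) y
    have h2 := hf.comp_measurePreserving hm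
    refine (eLpNorm_sub_le h2.1 hf.1 (by norm_num)).trans ?_
    rw [eLpNorm_comp_measurePreserving hf.1 hm]
  convert h1.add hf using 1
  ext x
  simp

/-- A sequence of bump functions shrinking to the origin. -/
noncomputable def bumpSeq (n : ℕ) (k : ℕ) : ContDiffBump (0 : Eu n) :=
  ⟨1 / (k + 1), 2 * (1 / (k + 1)), by positivity, by
    have : (0 : ℝ) < 1 / (k + 1) := by positivity
    linarith⟩

theorem tendsto_bumpSeq_rOut (n : ℕ) : Tendsto (fun k => (bumpSeq n k).rOut) atTop (𝓝 0) := by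
  simpa [bumpSeq] using (tendsto_one_div_add_atTop_nhds_zero_nat (𝕜 := ℝ)).const_mul 2

theorem ae_tendsto_moll [CompleteSpace F] {f : Eu n → F} (hf : LocallyIntegrable f) :
    ∀ᵐ x, Tendsto (fun k => moll (bumpSeq n k) f x) atTop (𝓝 (f x)) :=
  -- The constant 2 is the ratio `rOut / rIn` in `bumpSeq`; Lebesgue differentiation needs this
  -- ratio bounded.
  ContDiffBump.ae_convolution_tendsto_right_of_locallyIntegrable (K := 2)
    (tendsto_bumpSeq_rOut n) (Eventually.of_forall fun _ => le_rfl) hf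

end Mollification

/-! ### Cauchy–Schwarz and duality in `L²`. -/

section CauchySchwarz

variable {n : ℕ} {F : Type*} [NormedAddCommGroup F] [InnerProductSpace ℝ F]

theorem abs_integral_inner_le {f g : Eu n → F} (hf : MemLp f 2) (hg : MemLp g 2) :
    |∫ x, inner ℝ (f x) (g x)| ≤ (eLpNorm f 2).toReal * (eLpNorm g 2).toReal := by
  have h := norm_inner_le_norm (𝕜 := ℝ) (hf.toLp f) (hg.toLp g)
  rw [Lp.norm_toLp, Lp.norm_toLp, L2.inner_def] at h
  convert h using 1
  rw [Real.norm_eq_abs]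
  congr 1
  refine integral_congr_ae ?_
  filter_upwards [hf.coeFn_toLp, hg.coeFn_toLp] with x h1 h2
  rw [h1, h2]

theorem integrable_inner_of_memLp {f g : Eu n → F} (hf : MemLp f 2) (hg : MemLp g 2) :
    Integrable fun x => inner ℝ (f x) (g x) := by
  refine (L2.integrable_inner (𝕜 := ℝ) (hf.toLp f) (hg.toLp g)).congr ?_
  filter_upwards [hf.coeFn_toLp, hg.coeFn_toLp] with x h1 h2
  rw [h1, h2]

theorem abs_integral_mul_le {f g : Eu n → ℝ} (hf : MemLp f 2) (hg : MemLp g 2) :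
    |∫ x, f x * g x| ≤ (eLpNorm f 2).toReal * (eLpNorm g 2).toReal := by
  refine le_of_eq_of_le ?_ (abs_integral_inner_le hf hg)
  simp [mul_comm]

theorem tendsto_integral_inner {f : Eu n → F} {g : ℕ → Eu n → F} {g₀ : Eu n → F}
    (hf : MemLp f 2) (hg : ∀ k, MemLp (g k) 2) (hg₀ : MemLp g₀ 2)
    (h : Tendsto (fun k => eLpNorm (fun x => g k x - g₀ x) 2) atTop (𝓝 0)) :
    Tendsto (fun k => ∫ x, inner ℝ (f x) (g k x)) atTop (𝓝 (∫ x, inner ℝ (f x) (g₀ x))) := by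
  rw [tendsto_iff_norm_sub_tendsto_zero]
  have h1 : Tendsto (fun k => (eLpNorm f 2).toReal * (eLpNorm (fun x => g k x - g₀ x) 2).toReal)
      atTop (𝓝 ((eLpNorm f 2).toReal * (0 : ℝ≥0∞).toReal)) :=
    ((ENNReal.tendsto_toReal ENNReal.zero_ne_top).comp h).const_mul _
  rw [ENNReal.toReal_zero, mul_zero] at h1
  refine squeeze_zero (fun _ => norm_nonneg _) (fun k => ?_) h1
  have h2 := abs_integral_inner_le hf (g := fun x => g k x - g₀ x) ((hg k).sub hg₀)
  simp_rw [inner_sub_right] at h2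
  rw [integral_sub (integrable_inner_of_memLp hf (hg k))
    (integrable_inner_of_memLp hf hg₀)] at h2
  exact h2

/-- The bound is a closed condition on the test function and smooth compactly supported functions
are dense in `L²`, so `q` itself may be used as the test function. -/
theorem eLpNorm_le_of_forall_smooth {q : Eu n → ℝ} (hq : MemLp q 2) {C : ℝ} (hC : 0 ≤ C)
    (h : ∀ φ : Eu n → ℝ, ContDiff ℝ (⊤ : ℕ∞) φ → HasCompactSupport φ →
      |∫ x, φ x * q x| ≤ C * (eLpNorm φ 2).toReal) :
    eLpNorm q 2 ≤ ENNReal.ofReal C := by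
  have key : ∀ p : Lp ℝ 2 (volume : Measure (Eu n)), |inner ℝ p (hq.toLp q)| ≤ C * ‖p‖ := by
    have hcl : IsClosed {p : Lp ℝ 2 (volume : Measure (Eu n)) |
        |inner ℝ p (hq.toLp q)| ≤ C * ‖p‖} :=
      isClosed_le (by fun_prop) (by fun_prop)
    intro p
    refine hcl.closure_subset_iff.2 ?_
      ((Lp.dense_hasCompactSupport_contDiff (E := Eu n) (F := ℝ) (p := 2) (μ := volume)
        (by simp)) p)
    rintro p ⟨g, hpg, hg, hg'⟩
    have h1 := h g hg' hg
    simp only [Set.mem_ofPred_eq]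
    rw [L2.inner_def, Lp.norm_def, eLpNorm_congr_ae hpg]
    convert h1 using 2
    refine integral_congr_ae ?_
    filter_upwards [hpg, hq.coeFn_toLp] with x h2 h3
    rw [h2, h3]
    simp [mul_comm]
  have h1 := key (hq.toLp q)
  rw [real_inner_self_eq_norm_sq, abs_of_nonneg (by positivity)] at h1
  have h2 : ‖hq.toLp q‖ ≤ C := by
    by_contra! hlt
    nlinarith
  rw [Lp.norm_toLp] at h2
  exact (ENNReal.le_ofReal_iff_toReal_le hq.2.ne hC).2 h2

end CauchySchwarz

/-! ### Directional weak derivatives on `ℝⁿ`. -/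

section WeakDeriv

variable {n : ℕ} {F : Type*} [NormedAddCommGroup F] [NormedSpace ℝ F]

/-- `f` is the weak derivative of `v` on `ℝⁿ` in the direction `e`. -/
def HasWeakDeriv (v f : Eu n → F) (e : Eu n) : Prop :=
  ∀ φ : Eu n → ℝ, ContDiff ℝ (⊤ : ℕ∞) φ → HasCompactSupport φ →
    ∫ x, fderiv ℝ φ x e • v x = - ∫ x, φ x • f x

theorem _root_.ContDiff.fderiv_apply_const {φ : Eu n → ℝ} (hφ : ContDiff ℝ (⊤ : ℕ∞) φ)
    (e : Eu n) : ContDiff ℝ (⊤ : ℕ∞) fun x => fderiv ℝ φ x e :=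
  (hφ.fderiv_right (m := (⊤ : ℕ∞)) (by simp)).clm_apply contDiff_const

/-- The derivative first falls on `φ`; since `y ↦ φ (x - y)` is again a test function, the weak
derivative identity moves it to `v`, and the reflection cancels the sign. -/
theorem HasWeakDeriv.fderiv_convolution [CompleteSpace F] {v f : Eu n → F} {e : Eu n}
    (h : HasWeakDeriv v f e) (hv : LocallyIntegrable v) {φ : Eu n → ℝ}
    (hφ : ContDiff ℝ (⊤ : ℕ∞) φ) (hφc : HasCompactSupport φ) (x : Eu n) :
    fderiv ℝ (convolution φ v (lsmul ℝ ℝ) volume) x e =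
      convolution φ f (lsmul ℝ ℝ) volume x := by
  have h1 := hφc.hasFDerivAt_convolution_left (lsmul ℝ ℝ) (μ := volume)
    (hφ.of_le (by exact_mod_cast le_top)) hv x
  have hd : Continuous (fderiv ℝ φ) := hφ.continuous_fderiv (by simp)
  have hint : Integrable fun t => ((lsmul ℝ ℝ).precompL (Eu n) (fderiv ℝ φ t) :
      F →L[ℝ] Eu n →L[ℝ] F) (v (x - t)) :=
    (hφc.fderiv (𝕜 := ℝ)).convolutionExists_left
      ((lsmul ℝ ℝ).precompL (Eu n) : _ →L[ℝ] F →L[ℝ] Eu n →L[ℝ] F) hd hv x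
  rw [h1.fderiv, convolution_def, ContinuousLinearMap.integral_apply hint]
  simp only [precompL_apply, lsmul_apply]
  have h2 : ∀ y, fderiv ℝ (fun y => φ (x - y)) y e = - fderiv ℝ φ (x - y) e := fun y => by
    have : HasFDerivAt (fun y => φ (x - y)) ((fderiv ℝ φ (x - y)).comp (-.id ℝ (Eu n))) y :=
      HasFDerivAt.comp y ((hφ.differentiable (by simp)).differentiableAt.hasFDerivAt)
        ((hasFDerivAt_id y).const_sub x)
    rw [this.fderiv]
    simp
  have h3 := h (fun y => φ (x - y)) (by fun_prop)
    (hφc.comp_homeomorph (Homeomorph.subLeft x))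
  simp_rw [h2] at h3
  rw [convolution_eq_swap]
  simp only [lsmul_apply]
  rw [← integral_sub_left_eq_self (fun t => fderiv ℝ φ t e • v (x - t)) volume x]
  simp only [sub_sub_cancel]
  simp only [neg_smul, integral_neg, neg_inj] at h3
  exact h3

theorem HasWeakDeriv.fderiv_moll [CompleteSpace F] {v f : Eu n → F} {e : Eu n}
    (h : HasWeakDeriv v f e) (hv : LocallyIntegrable v) (ρ : ContDiffBump (0 : Eu n))
    (x : Eu n) : fderiv ℝ (moll ρ v) x e = moll ρ f x :=
  h.fderiv_convolution hv ρ.contDiff_normed ρ.hasCompactSupport_normed x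

theorem _root_.MeasureTheory.LocallyIntegrable.integrable_test_smul {v : Eu n → F}
    (hv : LocallyIntegrable v) {φ : Eu n → ℝ} (hφ : Continuous φ) (hφc : HasCompactSupport φ) :
    Integrable fun x => φ x • v x :=
  hv.integrable_smul_left_of_hasCompactSupport hφ hφc

theorem HasWeakDeriv.smul_test {v f : Eu n → F} {e : Eu n} (h : HasWeakDeriv v f e)
    (hv : LocallyIntegrable v) (hf : LocallyIntegrable f) {η : Eu n → ℝ}
    (hη : ContDiff ℝ (⊤ : ℕ∞) η) :
    HasWeakDeriv (fun x => η x • v x) (fun x => η x • f x + fderiv ℝ η x e • v x) e := by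
  intro φ hφ hφc
  have h1 := h (fun x => φ x * η x) (hφ.mul hη) hφc.mul_right
  have h2 : ∀ x, fderiv ℝ (fun x => φ x * η x) x e = φ x * fderiv ℝ η x e
      + η x * fderiv ℝ φ x e := fun x => by
    rw [fderiv_fun_mul (hφ.differentiable (by simp) x) (hη.differentiable (by simp) x)]
    simp
  have c1 := (hφ.fderiv_apply_const e).continuous
  have c2 := (hη.fderiv_apply_const e).continuous
  have i1 : Integrable fun x => (φ x * fderiv ℝ η x e) • v x :=
    hv.integrable_test_smul (hφ.continuous.mul c2) hφc.mul_right
  have i2 : Integrable fun x => (η x * fderiv ℝ φ x e) • v x :=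
    hv.integrable_test_smul (hη.continuous.mul c1) (hφc.fderiv_apply ℝ e).mul_left
  have i3 : Integrable fun x => (φ x * η x) • f x :=
    hf.integrable_test_smul (hφ.continuous.mul hη.continuous) hφc.mul_right
  simp_rw [h2, add_smul] at h1
  rw [integral_add i1 i2] at h1
  simp_rw [smul_add, smul_smul]
  rw [integral_add i3 i1]
  simp_rw [mul_comm (fderiv ℝ φ _ e)]
  rw [neg_add, ← h1]
  abel

theorem HasWeakDeriv.comp_add_right {v f : Eu n → F} {e : Eu n} (h : HasWeakDeriv v f e)
    (a : Eu n) : HasWeakDeriv (fun x => v (x + a)) (fun x => f (x + a)) e := by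
  intro φ hφ hφc
  have h1 := h (fun x => φ (x - a)) (by fun_prop)
    (hφc.comp_homeomorph (Homeomorph.subRight a))
  have h2 : ∀ x, fderiv ℝ (fun x => φ (x - a)) x e = fderiv ℝ φ (x - a) e := fun x => by
    rw [fderiv_comp_sub]
  simp_rw [h2] at h1
  rw [← integral_add_right_eq_self _ a, ← integral_add_right_eq_self (fun x => φ (x - a) • f x) a]
    at h1
  simpa using h1

theorem HasWeakDeriv.sub {v f w g : Eu n → F} {e : Eu n} (h : HasWeakDeriv v f e)
    (h' : HasWeakDeriv w g e) (hv : LocallyIntegrable v) (hf : LocallyIntegrable f)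
    (hw : LocallyIntegrable w) (hg : LocallyIntegrable g) :
    HasWeakDeriv (fun x => v x - w x) (fun x => f x - g x) e := by
  intro φ hφ hφc
  have c1 := (hφ.fderiv_apply_const e).continuous
  have hc := hφc.fderiv_apply ℝ e
  simp_rw [smul_sub]
  rw [integral_sub (hv.integrable_test_smul c1 hc) (hw.integrable_test_smul c1 hc),
    integral_sub (hf.integrable_test_smul hφ.continuous hφc)
      (hg.integrable_test_smul hφ.continuous hφc), h φ hφ hφc, h' φ hφ hφc]
  abel

/-- By duality it is enough to bound increments of `a ↦ ∫ φ(y) v(y + a) dy`. This function is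
smooth, its derivative along `e` is the same pairing with `f`, and the mean value inequality
applies. -/
theorem HasWeakDeriv.eLpNorm_translate_sub_le {v f : Eu n → ℝ} {e : Eu n}
    (h : HasWeakDeriv v f e) (hv : MemLp v 2) (hf : MemLp f 2) (t : ℝ) :
    eLpNorm (fun x => v (x + t • e) - v x) 2 ≤ ENNReal.ofReal (|t| * (eLpNorm f 2).toReal) := by
  have hvl : LocallyIntegrable v := hv.locallyIntegrable (by norm_num)
  have hq : MemLp (fun x => v (x + t • e) - v x) 2 :=
    (hv.comp_measurePreserving (measurePreserving_add_right volume (t • e))).sub hv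
  refine eLpNorm_le_of_forall_smooth hq (by positivity) fun φ hφ hφc => ?_
  -- Reflecting `φ` turns the pairing with translates of `v` into a convolution.
  let φ' : Eu n → ℝ := fun x => φ (-x)
  have hφ' : ContDiff ℝ (⊤ : ℕ∞) φ' := hφ.comp contDiff_neg
  have hφc' : HasCompactSupport φ' := hφc.comp_homeomorph (Homeomorph.neg _)
  have hφL : MemLp φ 2 := hφ.continuous.memLp_of_hasCompactSupport hφc
  have hφL' : MemLp φ' 2 := hφ'.continuous.memLp_of_hasCompactSupport hφc'
  have hN : eLpNorm φ' 2 volume = eLpNorm φ 2 volume :=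
    eLpNorm_comp_measurePreserving hφL.1 (Measure.measurePreserving_neg volume)
  set m : Eu n → ℝ := convolution φ' v (lsmul ℝ ℝ) volume with hm
  have hmd : Differentiable ℝ m :=
    (hφc'.contDiff_convolution_left (lsmul ℝ ℝ) hφ' hvl).differentiable (by simp)
  have hder : ∀ s : ℝ, HasDerivAt (fun s : ℝ => m (s • e)) (fderiv ℝ m (s • e) e) s := fun s => by
    have h1 : HasDerivAt (fun s : ℝ => s • e) e s := by
      simpa using (hasDerivAt_id s).smul_const e
    exact (hmd (s • e)).hasFDerivAt.comp_hasDerivAt s h1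
  have hbd : ∀ s : ℝ, ‖fderiv ℝ m (s • e) e‖ ≤ (eLpNorm φ 2).toReal * (eLpNorm f 2).toReal := by
    intro s
    rw [h.fderiv_convolution hvl hφ' hφc', convolution_lsmul]
    have hmp := Measure.measurePreserving_sub_left (volume : Measure (Eu n)) (s • e)
    have h1 := abs_integral_mul_le hφL' (hf.comp_measurePreserving hmp)
    rw [eLpNorm_comp_measurePreserving hf.1 hmp, hN] at h1
    simpa using h1
  have hmv := Convex.norm_image_sub_le_of_norm_hasDerivWithin_le (s := Set.univ)
    (f := fun s : ℝ => m (s • e)) (x := 0) (y := t)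
    (fun s _ => (hder s).hasDerivWithinAt) (fun s _ => hbd s) convex_univ trivial trivial
  have hm' : ∀ a, m a = ∫ y, φ y * v (y + a) := fun a => by
    rw [hm, convolution_lsmul, ← integral_neg_eq_self]
    simp [φ', add_comm]
  have i1 : Integrable fun y => φ y * v (y + t • e) :=
    (hφL.integrable_mul (hv.comp_measurePreserving
      (measurePreserving_add_right volume (t • e))))
  have i2 : Integrable fun y => φ y * v y := hφL.integrable_mul hv
  simp only [zero_smul, hm', add_zero, sub_zero] at hmv
  simp_rw [mul_sub]
  rw [integral_sub i1 i2]
  rw [Real.norm_eq_abs, Real.norm_eq_abs] at hmv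
  linarith

end WeakDeriv

/-! ### Enlarging the class of test functions. -/

section Test

variable {n : ℕ}

theorem gradient_apply (w : Eu n → ℝ) (x : Eu n) (i : Fin n) :
    (∇ w x) i = fderiv ℝ w x (EuclideanSpace.single i 1) := by
  rw [← inner_gradient_left (𝕜 := ℝ), EuclideanSpace.inner_single_right]
  simp

theorem moll_apply {n m : ℕ} (ρ : ContDiffBump (0 : Eu n)) {G : Eu n → Eu m}
    (hG : LocallyIntegrable G) (x : Eu n) (i : Fin m) :
    moll ρ G x i = moll ρ (fun y => G y i) x := by
  have h1 : Integrable fun t => ρ.normed volume t • G (x - t) :=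
    ρ.hasCompactSupport_normed.convolutionExists_left (lsmul ℝ ℝ) ρ.continuous_normed hG x
  have := (EuclideanSpace.proj (𝕜 := ℝ) i).integral_comp_comm h1
  simpa [moll, convolution_def] using this.symm

open scoped Pointwise in
theorem tsupport_moll_subset {F : Type*} [NormedAddCommGroup F] [NormedSpace ℝ F]
    (ρ : ContDiffBump (0 : Eu n)) {f : Eu n → F} {K : Set (Eu n)} (hK : IsCompact K)
    (hf : ∀ x, x ∉ K → f x = 0) : tsupport (moll ρ f) ⊆ Metric.cthickening ρ.rOut K := by
  refine closure_minimal ?_ Metric.isClosed_cthickening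
  refine (support_convolution_subset (lsmul ℝ ℝ)).trans ?_
  rw [ρ.support_normed_eq, add_comm (Metric.ball _ _), ← hK.add_closedBall_zero ρ.rOut_pos.le]
  exact Set.add_subset_add (fun x hx => by_contra fun h => hx (hf x h)) Metric.ball_subset_closedBall

/-- Allows `H¹` test functions with compact support in `N`: the mollifications of `ψ` are smooth,
have gradient the mollification of `Ψ`, are eventually supported in `N`, and these gradients
converge to `Ψ` in `L²`. -/
theorem integral_inner_eq_zero_of_weak {D : Eu n → Eu n} (hD : MemLp D 2) {N : Set (Eu n)}
    (hN : IsOpen N)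
    (hdiv : ∀ w : Eu n → ℝ, ContDiff ℝ (⊤ : ℕ∞) w → HasCompactSupport w → tsupport w ⊆ N →
      ∫ x, inner ℝ (D x) (∇ w x) = 0)
    {ψ : Eu n → ℝ} {Ψ : Eu n → Eu n} (hψ : MemLp ψ 2) (hΨ : MemLp Ψ 2)
    (hψΨ : ∀ i, HasWeakDeriv ψ (fun x => Ψ x i) (EuclideanSpace.single i 1))
    {K : Set (Eu n)} (hK : IsCompact K) (hKN : K ⊆ N) (hsupp : ∀ x, x ∉ K → ψ x = 0) :
    ∫ x, inner ℝ (D x) (Ψ x) = 0 := by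
  have hψl : LocallyIntegrable ψ := hψ.locallyIntegrable (by norm_num)
  have hΨl : LocallyIntegrable Ψ := hΨ.locallyIntegrable (by norm_num)
  have hgrad : ∀ k, ∇ (moll (bumpSeq n k) ψ) = moll (bumpSeq n k) Ψ := fun k => by
    ext x i
    rw [gradient_apply, (hψΨ i).fderiv_moll hψl, moll_apply _ hΨl]
  have hlim := tendsto_integral_inner hD (fun k => memLp_moll (bumpSeq n k) hΨ) hΨ
    (tendsto_eLpNorm_moll_sub (tendsto_bumpSeq_rOut n) hΨ)
  obtain ⟨δ, hδ, hδN⟩ := hK.exists_cthickening_subset_open hN hKN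
  refine tendsto_nhds_unique hlim (tendsto_const_nhds.congr' ?_)
  filter_upwards [(tendsto_bumpSeq_rOut n).eventually_lt_const hδ] with k hk
  have hts := tsupport_moll_subset (bumpSeq n k) hK hsupp
  rw [← hgrad]
  exact (hdiv _ (contDiff_moll _ hψl)
    (HasCompactSupport.of_support_subset_isCompact (hK.cthickening (r := (bumpSeq n k).rOut))
      ((subset_tsupport _).trans hts))
    (hts.trans ((Metric.cthickening_mono hk.le K).trans hδN))).symm

end Test

/-! ### Pointwise consequences of the Hessian bounds. -/

section Lagrangian

variable {n : ℕ} {L : Eu n → ℝ}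

theorem contDiff_gradient (hL : ContDiff ℝ 2 L) : ContDiff ℝ 1 (∇ L) :=
  (InnerProductSpace.toDual ℝ (Eu n)).symm.contDiff.comp (hL.fderiv_right (m := 1) (by norm_num))

theorem hasFDerivAt_gradient (hL : ContDiff ℝ 2 L) (p : Eu n) :
    HasFDerivAt (∇ L) (hessian L p) p :=
  ((contDiff_gradient hL).differentiable (by simp) p).hasFDerivAt

theorem continuous_hessian (hL : ContDiff ℝ 2 L) : Continuous (hessian L) :=
  (contDiff_gradient hL).continuous_fderiv (by simp)

theorem hasDerivAt_line (p q : Eu n) (t : ℝ) : HasDerivAt (fun s : ℝ => p + s • q) q t := by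
  simpa using ((hasDerivAt_id t).smul_const q).const_add p

theorem hasDerivAt_comp_line (hL : ContDiff ℝ 2 L) (p q : Eu n) (t : ℝ) :
    HasDerivAt (fun s : ℝ => L (p + s • q)) (inner ℝ (∇ L (p + t • q)) q) t := by
  rw [inner_gradient_left]
  exact ((hL.differentiable (by simp)) _).hasFDerivAt.comp_hasDerivAt t (hasDerivAt_line p q t)

theorem hasDerivAt_inner_gradient_line (hL : ContDiff ℝ 2 L) (p q : Eu n) (t : ℝ) :
    HasDerivAt (fun s : ℝ => inner ℝ (∇ L (p + s • q)) q)
      (inner ℝ (hessian L (p + t • q) q) q) t := by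
  have h := ((hasFDerivAt_gradient hL (p + t • q)).comp_hasDerivAt t (hasDerivAt_line p q t)).inner
    ℝ (hasDerivAt_const t q)
  simpa using h

theorem HessianLE.inner_gradient_line_le (hL : ContDiff ℝ 2 L) {Λ : ℝ} (h : HessianLE L Λ)
    (p q : Eu n) {t : ℝ} (ht : 0 ≤ t) :
    inner ℝ (∇ L (p + t • q)) q ≤ inner ℝ (∇ L p) q + Λ * t * ‖q‖ ^ 2 := by
  have hd : ∀ s, HasDerivAt (fun s : ℝ => Λ * s * ‖q‖ ^ 2 - inner ℝ (∇ L (p + s • q)) q)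
      (Λ * ‖q‖ ^ 2 - inner ℝ (hessian L (p + s • q) q) q) s := fun s => by
    have h1 : HasDerivAt (fun s : ℝ => Λ * s * ‖q‖ ^ 2) (Λ * ‖q‖ ^ 2) s := by
      simpa using ((hasDerivAt_id s).const_mul Λ).mul_const (‖q‖ ^ 2)
    exact h1.sub (hasDerivAt_inner_gradient_line hL p q s)
  have hm := monotone_of_hasDerivAt_nonneg hd (fun s => sub_nonneg.2 (h _ _)) ht
  simp only [mul_zero, zero_mul, zero_smul, add_zero] at hm
  linarith

theorem HessianGE.le_inner_gradient_line (hL : ContDiff ℝ 2 L) {lam : ℝ} (h : HessianGE L lam)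
    (p q : Eu n) {t : ℝ} (ht : 0 ≤ t) :
    inner ℝ (∇ L p) q + lam * t * ‖q‖ ^ 2 ≤ inner ℝ (∇ L (p + t • q)) q := by
  have hd : ∀ s, HasDerivAt (fun s : ℝ => inner ℝ (∇ L (p + s • q)) q - lam * s * ‖q‖ ^ 2)
      (inner ℝ (hessian L (p + s • q) q) q - lam * ‖q‖ ^ 2) s := fun s => by
    have h1 : HasDerivAt (fun s : ℝ => lam * s * ‖q‖ ^ 2) (lam * ‖q‖ ^ 2) s := by
      simpa using ((hasDerivAt_id s).const_mul lam).mul_const (‖q‖ ^ 2)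
    exact (hasDerivAt_inner_gradient_line hL p q s).sub h1
  have hm := monotone_of_hasDerivAt_nonneg hd (fun s => sub_nonneg.2 (h _ _)) ht
  simp only [mul_zero, zero_mul, zero_smul, add_zero] at hm
  linarith

theorem HessianGE.le_inner_gradient_sub (hL : ContDiff ℝ 2 L) {lam : ℝ} (h : HessianGE L lam)
    (p q : Eu n) : lam * ‖p - q‖ ^ 2 ≤ inner ℝ (∇ L p - ∇ L q) (p - q) := by
  have := h.le_inner_gradient_line hL q (p - q) zero_le_one
  rw [one_smul, add_sub_cancel, mul_one] at this
  rw [inner_sub_left]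
  linarith

/-- Integrates `HessianLE.inner_gradient_line_le` along the segment: the gap `k` between the two
sides is nondecreasing for `t ≥ 0`. This one-sided estimate is all the growth information on `L`
that (i) uses. -/
theorem HessianLE.le_taylor (hL : ContDiff ℝ 2 L) {Λ : ℝ} (h : HessianLE L Λ) (p q : Eu n) :
    L (p + q) ≤ L p + inner ℝ (∇ L p) q + Λ / 2 * ‖q‖ ^ 2 := by
  let k : ℝ → ℝ := fun t => Λ / 2 * t ^ 2 * ‖q‖ ^ 2 + t * inner ℝ (∇ L p) q - L (p + t • q)
  have hd : ∀ s, HasDerivAt k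
      (Λ * s * ‖q‖ ^ 2 + inner ℝ (∇ L p) q - inner ℝ (∇ L (p + s • q)) q) s := fun s => by
    have h1 : HasDerivAt (fun s : ℝ => Λ / 2 * s ^ 2 * ‖q‖ ^ 2) (Λ * s * ‖q‖ ^ 2) s := by
      refine (((hasDerivAt_pow 2 s).const_mul (Λ / 2)).mul_const (‖q‖ ^ 2)).congr_deriv ?_
      push_cast
      ring
    have h2 : HasDerivAt (fun s : ℝ => s * inner ℝ (∇ L p) q) (inner ℝ (∇ L p) q) s := by
      simpa using (hasDerivAt_id s).mul_const (inner ℝ (∇ L p) q)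
    exact (h1.add h2).sub (hasDerivAt_comp_line hL p q s)
  have hm : MonotoneOn k (Set.Ici 0) := by
    refine monotoneOn_of_deriv_nonneg (convex_Ici 0)
      (fun s _ => (hd s).continuousAt.continuousWithinAt)
      (fun s _ => (hd s).differentiableAt.differentiableWithinAt) fun s hs => ?_
    rw [interior_Ici, Set.mem_Ioi] at hs
    rw [(hd s).deriv]
    linarith [h.inner_gradient_line_le hL p q hs.le]
  have := hm (Set.mem_Ici.2 le_rfl) (Set.mem_Ici.2 zero_le_one) zero_le_one
  simp only [k, one_smul, zero_smul, add_zero] at this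
  linarith

theorem inner_hessian_comm (hL : ContDiff ℝ 2 L) (p x y : Eu n) :
    inner ℝ (hessian L p x) y = inner ℝ (hessian L p y) x := by
  have hsymm : IsSymmSndFDerivAt ℝ L p := hL.contDiffAt.isSymmSndFDerivAt (by simp)
  have h : ∀ a b, inner ℝ (hessian L p a) b = fderiv ℝ (fderiv ℝ L) p a b := fun a b => by
    have h1 : HasFDerivAt (fderiv ℝ L) (fderiv ℝ (fderiv ℝ L) p) p :=
      (((hL.fderiv_right (m := 1) (by norm_num)).differentiable (by simp)) p).hasFDerivAt
    have h2 := (InnerProductSpace.toDual ℝ (Eu n)).symm.toContinuousLinearEquiv.hasFDerivAt.comp p h1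
    have h3 := h2.unique (hasFDerivAt_gradient hL p)
    rw [← h3]
    simp
  rw [h, h, hsymm]

/-- Polarisation of the symmetric form: `4⟨Ax, y⟩ = ⟨A(x+y), x+y⟩ - ⟨A(x-y), x-y⟩ ≤ Λ‖x+y‖²`, which
the parallelogram law bounds by `2Λ(‖x‖² + ‖y‖²)`. -/
theorem norm_hessian_le (hL : ContDiff ℝ 2 L) {Λ : ℝ} (hΛ : 0 < Λ) (hU : HessianLE L Λ)
    (hG : HessianGE L 0) (p : Eu n) : ‖hessian L p‖ ≤ Λ := by
  refine ContinuousLinearMap.opNorm_le_bound _ hΛ.le fun x => ?_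
  set A := hessian L p with hA
  -- This scaling makes the `‖y‖²` term absorb exactly half of `4⟨Ax, y⟩`, leaving the sharp
  -- constant `Λ`.
  set y := Λ⁻¹ • A x with hy
  have h1 := hU p (x + y)
  have h2 := hG p (x - y)
  have hs := inner_hessian_comm hL p x y
  have hp := parallelogram_law_with_norm ℝ x y
  have hn := norm_add_sq_real x y
  have e : inner ℝ (A x) y = Λ⁻¹ * ‖A x‖ ^ 2 := by
    rw [hy, inner_smul_right, real_inner_self_eq_norm_sq]
  have ny : ‖y‖ = Λ⁻¹ * ‖A x‖ := by
    rw [hy, norm_smul, Real.norm_of_nonneg (by positivity)]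
  rw [← hA] at h1 h2 hs
  simp only [map_add, map_sub, inner_add_left, inner_add_right, inner_sub_left, inner_sub_right]
    at h1 h2
  have h3 : 4 * (Λ⁻¹ * ‖A x‖ ^ 2) ≤ 2 * Λ * (‖x‖ ^ 2 + (Λ⁻¹ * ‖A x‖) ^ 2) := by
    rw [← e, ← ny]
    have : 0 ≤ ‖x - y‖ * ‖x - y‖ := by positivity
    nlinarith
  have h4 : ‖A x‖ ^ 2 ≤ (Λ * ‖x‖) ^ 2 := by
    have h5 : 4 * (Λ⁻¹ * ‖A x‖ ^ 2) * Λ ≤ 2 * Λ * (‖x‖ ^ 2 + (Λ⁻¹ * ‖A x‖) ^ 2) * Λ :=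
      mul_le_mul_of_nonneg_right h3 hΛ.le
    have e1 : 4 * (Λ⁻¹ * ‖A x‖ ^ 2) * Λ = 4 * ‖A x‖ ^ 2 := by field_simp
    have e2 : 2 * Λ * (‖x‖ ^ 2 + (Λ⁻¹ * ‖A x‖) ^ 2) * Λ = 2 * (Λ * ‖x‖) ^ 2 + 2 * ‖A x‖ ^ 2 := by
      field_simp
    rw [e1, e2] at h5
    linarith
  exact (pow_le_pow_iff_left₀ (norm_nonneg _) (by positivity) two_ne_zero).1 h4

theorem norm_gradient_sub_le (hL : ContDiff ℝ 2 L) {Λ : ℝ} (hΛ : 0 < Λ) (hU : HessianLE L Λ)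
    (hG : HessianGE L 0) (p q : Eu n) : ‖∇ L p - ∇ L q‖ ≤ Λ * ‖p - q‖ :=
  Convex.norm_image_sub_le_of_norm_hasFDerivWithin_le (s := Set.univ)
    (fun x _ => (hasFDerivAt_gradient hL x).hasFDerivWithinAt)
    (fun x _ => norm_hessian_le hL hΛ hU hG x) convex_univ trivial trivial

theorem HessianGE.mono {a b : ℝ} (h : HessianGE L b) (hab : a ≤ b) : HessianGE L a := fun p ξ =>
  (mul_le_mul_of_nonneg_right hab (by positivity)).trans (h p ξ)

end Lagrangian

/-! ### From translation bounds to weak derivatives. -/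

section DifferenceQuotients

variable {n : ℕ}

theorem toReal_eLpNorm_sq {F : Type*} [NormedAddCommGroup F] [InnerProductSpace ℝ F]
    {f : Eu n → F} (hf : MemLp f 2) : (eLpNorm f 2).toReal ^ 2 = ∫ x, ‖f x‖ ^ 2 := by
  rw [← Lp.norm_toLp f hf, ← real_inner_self_eq_norm_sq, L2.inner_def]
  refine integral_congr_ae ?_
  filter_upwards [hf.coeFn_toLp] with x h
  rw [h, real_inner_self_eq_norm_sq]

/-- The bound makes `l` vanish on the kernel of `T`, so `l` descends to a bounded functional on the
range; Hahn–Banach extends it to `H` and Riesz represents it. No topology on `X` is involved. -/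
theorem exists_eq_inner_of_abs_le {X H : Type*} [AddCommGroup X] [Module ℝ X]
    [NormedAddCommGroup H] [InnerProductSpace ℝ H] [CompleteSpace H] (T : X →ₗ[ℝ] H)
    (l : X →ₗ[ℝ] ℝ) {C : ℝ} (h : ∀ x, |l x| ≤ C * ‖T x‖) :
    ∃ f : H, ∀ x, l x = inner ℝ f (T x) := by
  obtain ⟨s, hs⟩ := T.rangeRestrict.exists_rightInverse_of_surjective T.range_rangeRestrict
  have hs' : ∀ y, T (s y) = y := fun y => by
    simpa using congrArg Subtype.val (LinearMap.congr_fun hs y)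
  let l' : T.range →L[ℝ] ℝ := (l ∘ₗ s).mkContinuous C fun y => by
    simpa [hs'] using h (s y)
  obtain ⟨g, hg, -⟩ := _root_.exists_extension_norm_eq _ l'
  refine ⟨(InnerProductSpace.toDual ℝ H).symm g, fun x => ?_⟩
  rw [InnerProductSpace.toDual_symm_apply]
  have h1 : g (T x) = l (s (T.rangeRestrict x)) := hg (T.rangeRestrict x)
  have h2 : l (x - s (T.rangeRestrict x)) = 0 := by
    have := h (x - s (T.rangeRestrict x))
    rw [map_sub T, hs'] at this
    simpa using this
  rw [h1, ← sub_eq_zero, ← map_sub, h2]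

/-- The functional `φ ↦ -∫ ∂ₑφ g` is the derivative at `t = 0` of `∫ φ(x) g(x + t e) dx`, so the
increment bound makes it bounded by `C` times the `L²` norm of `φ`. Representing it by an `L²`
function replaces the extraction of a weak limit of difference quotients. -/
theorem exists_weakDeriv_of_translate_le {g : Eu n → ℝ} (hg : MemLp g 2) (e : Eu n)
    (V : Opens (Eu n)) {C δ : ℝ} (hC : 0 ≤ C) (hδ : 0 < δ)
    (h : ∀ t : ℝ, |t| < δ → ∀ φ : 𝓓(V, ℝ),
      |∫ x, φ x * (g (x + t • e) - g x)| ≤ C * |t| * (eLpNorm φ 2).toReal) :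
    ∃ f : Eu n → ℝ, MemLp f 2 ∧
      ∀ φ : 𝓓(V, ℝ), ∫ x, fderiv ℝ φ x e * g x = - ∫ x, φ x * f x := by
  have hgl : LocallyIntegrable g := hg.locallyIntegrable (by norm_num)
  have hφL : ∀ φ : 𝓓(V, ℝ), MemLp φ 2 (volume : Measure (Eu n)) := fun φ =>
    φ.continuous.memLp_of_hasCompactSupport φ.hasCompactSupport
  have hint : ∀ φ : 𝓓(V, ℝ), Integrable fun x => fderiv ℝ φ x e * g x := fun φ =>
    hgl.integrable_test_smul (φ.contDiff.fderiv_apply_const e).continuous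
      (φ.hasCompactSupport.fderiv_apply ℝ e)
  let T : 𝓓(V, ℝ) →ₗ[ℝ] Lp ℝ 2 (volume : Measure (Eu n)) :=
    { toFun := fun φ => (hφL φ).toLp φ
      map_add' := fun _ _ => rfl
      map_smul' := fun _ _ => rfl }
  let l : 𝓓(V, ℝ) →ₗ[ℝ] ℝ :=
    { toFun := fun φ => - ∫ x, fderiv ℝ φ x e * g x
      map_add' := fun φ ψ => by
        rw [← neg_add, ← integral_add (hint φ) (hint ψ)]
        congr 1
        refine integral_congr_ae (ae_of_all _ fun x => ?_)
        have : fderiv ℝ (⇑(φ + ψ)) x = fderiv ℝ φ x + fderiv ℝ ψ x :=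
          fderiv_add (φ.contDiff.differentiable (by simp) x)
            (ψ.contDiff.differentiable (by simp) x)
        simp only [this, add_apply, add_mul]
      map_smul' := fun c φ => by
        rw [RingHom.id_apply, smul_eq_mul, mul_neg, ← integral_const_mul]
        congr 1
        refine integral_congr_ae (ae_of_all _ fun x => ?_)
        have : fderiv ℝ (⇑(c • φ)) x = c • fderiv ℝ φ x :=
          fderiv_const_smul (φ.contDiff.differentiable (by simp) x) c
        simp only [this, smul_apply, smul_eq_mul, mul_assoc] }
  have hl : ∀ φ, |l φ| ≤ C * ‖T φ‖ := fun φ => by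
    change |-∫ x, fderiv ℝ φ x e * g x| ≤ C * ‖(hφL φ).toLp φ‖
    rw [Lp.norm_toLp]
    let φ' : Eu n → ℝ := fun x => φ (-x)
    have hφ' : ContDiff ℝ (⊤ : ℕ∞) φ' := φ.contDiff.comp contDiff_neg
    have hφc' : HasCompactSupport φ' := φ.hasCompactSupport.comp_homeomorph (Homeomorph.neg _)
    set m : Eu n → ℝ := convolution φ' g (lsmul ℝ ℝ) volume with hm
    have hm' : ∀ a, m a = ∫ y, φ y * g (y + a) := fun a => by
      rw [hm, convolution_lsmul, ← integral_neg_eq_self]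
      simp [φ', add_comm]
    have hmd := (hφc'.hasFDerivAt_convolution_left (lsmul ℝ ℝ) (μ := volume)
      (hφ'.of_le (by exact_mod_cast le_top)) hgl 0)
    have hd : Continuous (fderiv ℝ φ') := hφ'.continuous_fderiv (by simp)
    have hi : Integrable fun t => ((lsmul ℝ ℝ).precompL (Eu n) (fderiv ℝ φ' t) :
        ℝ →L[ℝ] Eu n →L[ℝ] ℝ) (g (0 - t)) :=
      (hφc'.fderiv (𝕜 := ℝ)).convolutionExists_left
        ((lsmul ℝ ℝ).precompL (Eu n) : _ →L[ℝ] ℝ →L[ℝ] Eu n →L[ℝ] ℝ) hd hgl 0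
    have hder : fderiv ℝ m 0 e = - ∫ x, fderiv ℝ φ x e * g x := by
      rw [hm, hmd.fderiv, convolution_def, ContinuousLinearMap.integral_apply hi,
        ← integral_neg_eq_self, ← integral_neg]
      refine integral_congr_ae (ae_of_all _ fun x => ?_)
      have h2 : fderiv ℝ φ' (-x) = - fderiv ℝ φ x := by
        have h3 : HasFDerivAt φ' ((fderiv ℝ φ (- -x)).comp (-.id ℝ (Eu n))) (-x) :=
          HasFDerivAt.comp (-x) ((φ.contDiff.differentiable (by simp)) _).hasFDerivAt
            (hasFDerivAt_id (-x)).neg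
        rw [h3.fderiv, neg_neg]
        ext
        simp
      simp [h2]
    have hline : HasDerivAt (fun s : ℝ => m (s • e)) (fderiv ℝ m 0 e) 0 := by
      have h1 : HasDerivAt (fun s : ℝ => s • e) e 0 := by
        simpa using (hasDerivAt_id (0 : ℝ)).smul_const e
      have h2 : HasFDerivAt m (fderiv ℝ m 0) ((0 : ℝ) • e) := by
        rw [zero_smul]
        exact hmd.differentiableAt.hasFDerivAt
      exact h2.comp_hasDerivAt 0 h1
    rw [← hder, ← Real.norm_eq_abs]
    refine hline.le_of_lip' (by positivity) ?_
    filter_upwards [Metric.ball_mem_nhds (0 : ℝ) hδ] with t ht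
    rw [mem_ball_zero_iff, Real.norm_eq_abs] at ht
    have h1 := h t ht φ
    have i1 : Integrable fun y => φ y * g (y + t • e) :=
      (hφL φ).integrable_mul (hg.comp_measurePreserving
        (measurePreserving_add_right volume (t • e)))
    have i2 : Integrable fun y => φ y * g y := (hφL φ).integrable_mul hg
    simp_rw [mul_sub] at h1
    rw [integral_sub i1 i2] at h1
    simp only [zero_smul, hm', add_zero, sub_zero, Real.norm_eq_abs]
    linarith
  obtain ⟨f, hf⟩ := exists_eq_inner_of_abs_le T l hl
  refine ⟨f, Lp.memLp f, fun φ => ?_⟩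
  have h1 : - ∫ x, fderiv ℝ φ x e * g x = inner ℝ f ((hφL φ).toLp φ) := hf φ
  rw [← neg_eq_iff_eq_neg, h1, L2.inner_def]
  refine integral_congr_ae ?_
  filter_upwards [(hφL φ).coeFn_toLp] with x hx
  rw [hx]
  simp

end DifferenceQuotients

/-! ### The energy estimate for translation increments. -/

section Caccioppoli

variable {n : ℕ}

theorem integrable_inner_of_hasCompactSupport {D W : Eu n → Eu n} (hD : LocallyIntegrable D)
    (hW : Continuous W) (hWc : HasCompactSupport W) : Integrable fun x => inner ℝ (D x) (W x) := by
  have h1 : Integrable fun x => ‖W x‖ • D x :=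
    hD.integrable_smul_left_of_hasCompactSupport hW.norm hWc.norm
  refine h1.mono (hD.aestronglyMeasurable.inner hW.aestronglyMeasurable) (ae_of_all _ fun x => ?_)
  rw [norm_smul, norm_norm, mul_comm]
  exact norm_inner_le_norm _ _

theorem _root_.ContDiff.continuous_gradient {w : Eu n → ℝ} (hw : ContDiff ℝ (⊤ : ℕ∞) w) :
    Continuous (∇ w) :=
  (InnerProductSpace.toDual ℝ (Eu n)).symm.continuous.comp (hw.continuous_fderiv (by simp))

theorem _root_.HasCompactSupport.gradient {w : Eu n → ℝ} (hw : HasCompactSupport w) :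
    HasCompactSupport (∇ w) :=
  (hw.fderiv (𝕜 := ℝ)).comp_left (map_zero (InnerProductSpace.toDual ℝ (Eu n)).symm)

theorem memLp_gradient_comp_sub {L : Eu n → ℝ} (hL : ContDiff ℝ 2 L) {Λ : ℝ} (hΛ : 0 < Λ)
    (hU : HessianLE L Λ) (hG : HessianGE L 0) {g h : Eu n → Eu n}
    (hg : AEStronglyMeasurable g) (hh : AEStronglyMeasurable h)
    (hgh : MemLp (fun x => g x - h x) 2) : MemLp (fun x => ∇ L (g x) - ∇ L (h x)) 2 :=
  hgh.of_le_mul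
    (((contDiff_gradient hL).continuous.comp_aestronglyMeasurable hg).sub
      ((contDiff_gradient hL).continuous.comp_aestronglyMeasurable hh))
    (ae_of_all _ fun _ => norm_gradient_sub_le hL hΛ hU hG _ _)

theorem locallyIntegrable_gradient_comp {L : Eu n → ℝ} (hL : ContDiff ℝ 2 L) {Λ : ℝ} (hΛ : 0 < Λ)
    (hU : HessianLE L Λ) (hG : HessianGE L 0) {g : Eu n → Eu n} (hg : MemLp g 2) :
    LocallyIntegrable fun x => ∇ L (g x) := by
  have h1 : MemLp (fun x => ∇ L (g x) - ∇ L 0) 2 :=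
    memLp_gradient_comp_sub hL hΛ hU hG hg.1 aestronglyMeasurable_const (by simpa using hg)
  have h2 := (h1.locallyIntegrable (by norm_num)).add
    (locallyIntegrable_const (μ := (volume : Measure (Eu n))) (∇ L 0))
  refine h2.congr (ae_of_all _ fun x => ?_)
  simp

/-- With `q`, `P`, `D` the increments of `v`, `g`, `∇L(g)`, the field `D` is weakly divergence free
on `N`, because `N` and `N + h` both lie in `O`. Test with `η² q`: strong monotonicity bounds the
main term below, and the Lipschitz bound and Young's inequality absorb the term containing `∇η`. -/
theorem caccioppoli {L : Eu n → ℝ} (hL : ContDiff ℝ 2 L) {Λ lam : ℝ} (hΛ : 0 < Λ)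
    (hlam : 0 < lam) (hU : HessianLE L Λ) (hG : HessianGE L lam) {v : Eu n → ℝ}
    {g : Eu n → Eu n} (hv : MemLp v 2) (hg : MemLp g 2)
    (hvg : ∀ i, HasWeakDeriv v (fun x => g x i) (EuclideanSpace.single i 1)) {O N : Set (Eu n)}
    (hN : IsOpen N)
    (hdiv : ∀ w : Eu n → ℝ, ContDiff ℝ (⊤ : ℕ∞) w → HasCompactSupport w → tsupport w ⊆ O →
      ∫ x, inner ℝ (∇ L (g x)) (∇ w x) = 0)
    {η : Eu n → ℝ} (hη : ContDiff ℝ (⊤ : ℕ∞) η) (hηc : HasCompactSupport η) (hηN : tsupport η ⊆ N)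
    {M : ℝ} (hM : ∀ x, ‖∇ η x‖ ≤ M) {h : Eu n} (hNO : N ⊆ O) (hNh : ∀ x ∈ N, x + h ∈ O) :
    ∫ x, (η x * ‖g (x + h) - g x‖) ^ 2 ≤
      (2 * Λ * M / lam) ^ 2 * ∫ x, (v (x + h) - v x) ^ 2 := by
  have hG0 : HessianGE L 0 := hG.mono hlam.le
  have hmp := measurePreserving_add_right (volume : Measure (Eu n)) h
  have hvh : MemLp (fun x => v (x + h)) 2 := hv.comp_measurePreserving hmp
  have hgh : MemLp (fun x => g (x + h)) 2 := hg.comp_measurePreserving hmp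
  set q : Eu n → ℝ := fun x => v (x + h) - v x with hq
  set P : Eu n → Eu n := fun x => g (x + h) - g x with hP
  set D : Eu n → Eu n := fun x => ∇ L (g (x + h)) - ∇ L (g x) with hDdef
  have hqL : MemLp q 2 := hvh.sub hv
  have hPL : MemLp P 2 := hgh.sub hg
  have hD : MemLp D 2 := memLp_gradient_comp_sub hL hΛ hU hG0 hgh.1 hg.1 hPL
  have hdivD : ∀ w : Eu n → ℝ, ContDiff ℝ (⊤ : ℕ∞) w → HasCompactSupport w → tsupport w ⊆ N →
      ∫ x, inner ℝ (D x) (∇ w x) = 0 := by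
    intro w hw hwc hwN
    have i1 := integrable_inner_of_hasCompactSupport
      (locallyIntegrable_gradient_comp hL hΛ hU hG0 hgh) hw.continuous_gradient hwc.gradient
    have i2 := integrable_inner_of_hasCompactSupport
      (locallyIntegrable_gradient_comp hL hΛ hU hG0 hg) hw.continuous_gradient hwc.gradient
    simp_rw [hDdef, inner_sub_left]
    rw [integral_sub i1 i2, hdiv w hw hwc (hwN.trans hNO), sub_zero]
    have h1 := hdiv (fun x => w (x - h)) (by fun_prop)
      (hwc.comp_homeomorph (Homeomorph.subRight h)) ?_
    · rw [← integral_add_right_eq_self _ h] at h1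
      rw [← h1]
      refine integral_congr_ae (ae_of_all _ fun x => ?_)
      simp only [gradient, fderiv_comp_sub, add_sub_cancel_right]
    · have h2 : tsupport (fun x => w (x - h)) = (Homeomorph.subRight h) ⁻¹' tsupport w :=
        tsupport_comp_eq_preimage w (Homeomorph.subRight h)
      rw [h2]
      intro x hx
      simpa using hNh _ (hwN hx)
  have hη2 : ContDiff ℝ (⊤ : ℕ∞) fun x => η x * η x := hη.mul hη
  have hgη : ∀ x, ∇ (fun x => η x * η x) x = (2 * η x) • ∇ η x := fun x => by
    ext i
    rw [gradient_apply, PiLp.smul_apply, gradient_apply,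
      fderiv_fun_mul (hη.differentiable (by simp) x) (hη.differentiable (by simp) x)]
    simp
    ring
  obtain ⟨B, hB⟩ := hη.continuous.bounded_above_of_compact_support hηc
  have hBM : ∀ {F : Type} [NormedAddCommGroup F] [NormedSpace ℝ F] {f : Eu n → F},
      MemLp f 2 → MemLp (fun x => η x • f x) 2 := fun {F} _ _ {f} hf =>
    hf.of_le_mul (hη.continuous.aestronglyMeasurable.smul hf.1) (ae_of_all _ fun x => by
      rw [norm_smul]
      exact mul_le_mul_of_nonneg_right (hB x) (norm_nonneg _))
  have hψ : MemLp (fun x => (η x * η x) • q x) 2 := by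
    simpa only [smul_smul] using hBM (hBM hqL)
  have hqη : MemLp (fun x => q x • ∇ η x) 2 :=
    hqL.of_le_mul (hqL.1.smul hη.continuous_gradient.aestronglyMeasurable)
      (c := M) (ae_of_all _ fun x => by
        rw [norm_smul, mul_comm]
        exact mul_le_mul_of_nonneg_right (hM x) (norm_nonneg _))
  -- The weak gradient of `η² q`.
  set Ψ : Eu n → Eu n := fun x => η x • η x • P x + (2 : ℝ) • η x • q x • ∇ η x with hΨdef
  have hΨ : MemLp Ψ 2 := (hBM (hBM hPL)).add ((hBM hqη).const_smul (2 : ℝ))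
  have hcoord : ∀ {G : Eu n → Eu n} (i : Fin n), LocallyIntegrable G →
      LocallyIntegrable fun x => G x i := fun {G} i hG x => by
    obtain ⟨s, hs, hi⟩ := hG x
    exact ⟨s, hs, (EuclideanSpace.proj (𝕜 := ℝ) i).integrable_comp hi⟩
  have hψΨ : ∀ i, HasWeakDeriv (fun x => (η x * η x) • q x) (fun x => Ψ x i)
      (EuclideanSpace.single i 1) := fun i => by
    have l1 := hv.locallyIntegrable (by norm_num)
    have l2 := hvh.locallyIntegrable (by norm_num)
    have l3 := hcoord i (hg.locallyIntegrable (by norm_num))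
    have l4 := hcoord i (hgh.locallyIntegrable (by norm_num))
    have h1 := (((hvg i).comp_add_right h).sub (hvg i) l2 l4 l1 l3).smul_test (l2.sub l1)
      (l4.sub l3) hη2
    convert h1 using 2 with x
    rw [← gradient_apply, hgη]
    simp [hΨdef, hP, hq]
    ring
  have hzero := integral_inner_eq_zero_of_weak hD hN hdivD hψ hΨ hψΨ (K := tsupport η) hηc hηN
    (fun x hx => by simp [image_eq_zero_of_notMem_tsupport hx])
  -- Young's inequality is weighted so that the cross term costs half of `lam η²‖P‖²`; multiplying
  -- the other half by `2 / lam` at the end produces `(2ΛM/lam)²`.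
  have hpt : ∀ x, (lam / 2) * (η x * ‖P x‖) ^ 2 ≤
      inner ℝ (D x) (Ψ x) + 2 * Λ ^ 2 / lam * M ^ 2 * q x ^ 2 := fun x => by
    have h1 : lam * ‖P x‖ ^ 2 ≤ inner ℝ (D x) (P x) := hG.le_inner_gradient_sub hL _ _
    have h2 : ‖D x‖ ≤ Λ * ‖P x‖ := norm_gradient_sub_le hL hΛ hU hG0 _ _
    have h3 : |inner ℝ (D x) (∇ η x)| ≤ Λ * ‖P x‖ * M :=
      (abs_real_inner_le_norm _ _).trans
        (mul_le_mul h2 (hM x) (norm_nonneg _) (by positivity))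
    have h4 : inner ℝ (D x) (Ψ x) =
        η x ^ 2 * inner ℝ (D x) (P x) + 2 * (η x * q x) * inner ℝ (D x) (∇ η x) := by
      simp only [hΨdef, inner_add_right, inner_smul_right]
      ring
    have h5 : - (2 * (η x * q x) * inner ℝ (D x) (∇ η x)) ≤
        2 * |η x * q x| * (Λ * ‖P x‖ * M) := by
      refine (neg_le_abs _).trans ?_
      rw [abs_mul, abs_mul, abs_two]
      exact mul_le_mul_of_nonneg_left h3 (by positivity)
    have h6 : 2 * |η x * q x| * (Λ * ‖P x‖ * M) ≤
        lam / 2 * (η x * ‖P x‖) ^ 2 + 2 * Λ ^ 2 / lam * M ^ 2 * q x ^ 2 := by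
      have h7 := sq_nonneg (lam * (|η x| * ‖P x‖) - 2 * Λ * M * |q x|)
      have e1 : lam / 2 * (η x * ‖P x‖) ^ 2 + 2 * Λ ^ 2 / lam * M ^ 2 * q x ^ 2 -
          2 * |η x * q x| * (Λ * ‖P x‖ * M) =
          (lam * (|η x| * ‖P x‖) - 2 * Λ * M * |q x|) ^ 2 / (2 * lam) := by
        rw [abs_mul, mul_pow, ← sq_abs (η x), ← sq_abs (q x)]
        field_simp
        ring
      have : 0 ≤ (lam * (|η x| * ‖P x‖) - 2 * Λ * M * |q x|) ^ 2 / (2 * lam) := by positivity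
      linarith
    have h8 : η x ^ 2 * (lam * ‖P x‖ ^ 2) ≤ η x ^ 2 * inner ℝ (D x) (P x) :=
      mul_le_mul_of_nonneg_left h1 (by positivity)
    rw [h4]
    nlinarith
  have i1 : Integrable fun x => (η x * ‖P x‖) ^ 2 := by
    simpa [norm_smul, mul_pow] using (hBM hPL).integrable_norm_pow (p := 2) (by norm_num)
  have i2 : Integrable fun x => q x ^ 2 := hqL.integrable_sq
  have i3 := integrable_inner_of_memLp hD hΨ
  have hI := integral_mono (i1.const_mul (lam / 2))
    (i3.add (i2.const_mul (2 * Λ ^ 2 / lam * M ^ 2))) hpt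
  simp only [Pi.add_apply] at hI
  rw [integral_add i3 (i2.const_mul _), hzero, zero_add, integral_const_mul,
    integral_const_mul] at hI
  have e : (2 * Λ * M / lam) ^ 2 * ∫ x, q x ^ 2 =
      2 / lam * (2 * Λ ^ 2 / lam * M ^ 2 * ∫ x, q x ^ 2) := by
    field_simp
  rw [e]
  calc ∫ x, (η x * ‖P x‖) ^ 2 = 2 / lam * (lam / 2 * ∫ x, (η x * ‖P x‖) ^ 2) := by
        field_simp
    _ ≤ _ := mul_le_mul_of_nonneg_left hI (by positivity)

end Caccioppoli

/-! ### Cutoffs, and passing between `U` and `ℝⁿ`. -/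

section Localization

variable {n : ℕ} {U : Opens (Eu n)}

theorem exists_cutoff {K : Set (Eu n)} (hK : IsCompact K) {O : Set (Eu n)} (hO : IsOpen O)
    (hKO : K ⊆ O) :
    ∃ χ : Eu n → ℝ, ContDiff ℝ (⊤ : ℕ∞) χ ∧ HasCompactSupport χ ∧ tsupport χ ⊆ O ∧
      ∀ᶠ x in 𝓝ˢ K, χ x = 1 := by
  obtain ⟨K', hK', hKK', hK'O⟩ := exists_compact_between hK hO hKO
  obtain ⟨f, h1, h0, -⟩ := exists_contMDiffMap_one_nhds_of_subset_interior (n := (⊤ : ℕ∞))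
    (modelWithCornersSelf ℝ (Eu n)) hK.isClosed hKK'
  have hs : tsupport f ⊆ K' :=
    closure_minimal (fun x hx => by_contra fun h => hx (h0 x h)) hK'.isClosed
  exact ⟨f, f.contMDiff.contDiff, HasCompactSupport.of_support_subset_isCompact hK'
    ((subset_tsupport _).trans hs), hs.trans hK'O, h1⟩

theorem integrable_test_smul_of_tsupport_subset {F : Type*} [NormedAddCommGroup F]
    [NormedSpace ℝ F] {f : Eu n → F} (hf : LocallyIntegrableOn f U) {φ : Eu n → ℝ}
    (hφ : Continuous φ) (hφc : HasCompactSupport φ) (hφU : tsupport φ ⊆ U) :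
    Integrable fun x => φ x • f x := by
  have h1 : IntegrableOn (fun x => φ x • f x) (tsupport φ) :=
    (hf.integrableOn_compact_subset hφU hφc).continuousOn_smul hφ.continuousOn hφc
  refine (integrableOn_iff_integrable_of_support_subset ?_).1 h1
  intro x hx
  refine subset_tsupport φ fun h => hx ?_
  simp [h]

theorem setIntegral_eq_of_tsupport_subset {F G : Type*} [NormedAddCommGroup F] [NormedSpace ℝ F]
    [Zero G] {f : Eu n → F} {φ : Eu n → G} (hφU : tsupport φ ⊆ U)
    (h : ∀ x, φ x = 0 → f x = 0) : ∫ x in U, f x = ∫ x, f x :=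
  setIntegral_eq_integral_of_forall_compl_eq_zero fun x hx =>
    h x (image_eq_zero_of_notMem_tsupport fun h' => hx (hφU h'))

theorem tsupport_fderiv_apply_subset (φ : Eu n → ℝ) (e : Eu n) :
    tsupport (fun x => fderiv ℝ φ x e) ⊆ tsupport φ :=
  closure_minimal (fun x hx => support_fderiv_subset ℝ fun h => hx (by simp [h]))
    (isClosed_tsupport φ)

theorem tsupport_gradient_subset (φ : Eu n → ℝ) : tsupport (∇ φ) ⊆ tsupport φ :=
  closure_minimal (fun x hx => support_fderiv_subset ℝ fun h => hx (by simp [gradient, h]))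
    (isClosed_tsupport φ)

theorem locallyIntegrableOn_coord {s : Set (Eu n)} {G : Eu n → Eu n}
    (hG : LocallyIntegrableOn G s) (i : Fin n) : LocallyIntegrableOn (fun x => G x i) s :=
  fun x hx => by
    obtain ⟨t, ht, h⟩ := hG x hx
    exact ⟨t, ht, (EuclideanSpace.proj (𝕜 := ℝ) i).integrable_comp h⟩

/-- Test functions vanish off `U`, so the integrals extend to `ℝⁿ`, the form used by `HasWeakDeriv`.
-/
theorem IsWeakGrad.integral_fderiv_mul {u : Eu n → ℝ} {G : Eu n → Eu n} (h : IsWeakGrad U u G)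
    (φ : 𝓓(U, ℝ)) (i : Fin n) :
    ∫ x, fderiv ℝ φ x (EuclideanSpace.single i 1) * u x = - ∫ x, φ x * G x i := by
  have h1 := h.integral_eq φ i
  simp_rw [gradient_apply] at h1
  rw [setIntegral_eq_of_tsupport_subset
      ((tsupport_fderiv_apply_subset φ (EuclideanSpace.single i 1)).trans φ.tsupport_subset)
      (fun x hx => by simp [hx]),
    setIntegral_eq_of_tsupport_subset φ.tsupport_subset (fun x hx => by simp [hx])] at h1
  simp_rw [mul_comm (fderiv ℝ φ _ _), mul_comm (φ _)]
  exact h1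

theorem isWeakGrad_of_integral_fderiv_mul {u : Eu n → ℝ} {G : Eu n → Eu n}
    (hu : LocallyIntegrableOn u U) (hG : LocallyIntegrableOn G U)
    (h : ∀ (φ : 𝓓(U, ℝ)) (i : Fin n),
      ∫ x, fderiv ℝ φ x (EuclideanSpace.single i 1) * u x = - ∫ x, φ x * G x i) :
    IsWeakGrad U u G := by
  refine ⟨hu, hG, fun φ i => ?_⟩
  have h1 := h φ i
  simp_rw [gradient_apply]
  rw [setIntegral_eq_of_tsupport_subset
      ((tsupport_fderiv_apply_subset φ (EuclideanSpace.single i 1)).trans φ.tsupport_subset)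
      (fun x hx => by simp [hx]),
    setIntegral_eq_of_tsupport_subset φ.tsupport_subset (fun x hx => by simp [hx])]
  simp_rw [mul_comm (u _), mul_comm (G _ _)]
  exact h1

theorem IsWeakGrad.mono {V : Opens (Eu n)} (hVU : V ≤ U) {u : Eu n → ℝ} {G : Eu n → Eu n}
    (h : IsWeakGrad U u G) : IsWeakGrad V u G :=
  isWeakGrad_of_integral_fderiv_mul (h.locInt.mono_set hVU) (h.locInt_grad.mono_set hVU)
    fun φ i => h.integral_fderiv_mul
      ⟨φ, φ.contDiff, φ.hasCompactSupport, φ.tsupport_subset.trans hVU⟩ i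

theorem isWeakGrad_test (w : 𝓓(U, ℝ)) : IsWeakGrad U w (∇ w) := by
  refine isWeakGrad_of_integral_fderiv_mul
    (w.continuous.locallyIntegrable.locallyIntegrableOn _)
    ((ContDiff.continuous_gradient w.contDiff).locallyIntegrable.locallyIntegrableOn _)
    fun φ i => ?_
  have c1 := (φ.contDiff.fderiv_apply_const (EuclideanSpace.single i 1)).continuous
  have c2 := (w.contDiff.fderiv_apply_const (EuclideanSpace.single i 1)).continuous
  have hc := φ.hasCompactSupport
  have h1 := integral_mul_fderiv_eq_neg_fderiv_mul_of_integrable (μ := volume)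
    (f := φ) (g := w) (v := EuclideanSpace.single i 1)
    ((c1.mul w.continuous).integrable_of_hasCompactSupport (hc.fderiv_apply ℝ _).mul_right)
    ((φ.continuous.mul c2).integrable_of_hasCompactSupport hc.mul_right)
    ((φ.continuous.mul w.continuous).integrable_of_hasCompactSupport hc.mul_right)
    (fun x _ => φ.contDiff.differentiable (by simp) x)
    (fun x _ => w.contDiff.differentiable (by simp) x)
  simp_rw [gradient_apply]
  rw [h1, neg_neg]

theorem IsWeakGrad.add {u v : Eu n → ℝ} {G H : Eu n → Eu n} (hu : IsWeakGrad U u G)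
    (hv : IsWeakGrad U v H) : IsWeakGrad U (fun x => u x + v x) (fun x => G x + H x) := by
  refine isWeakGrad_of_integral_fderiv_mul (hu.locInt.add hv.locInt)
    (hu.locInt_grad.add hv.locInt_grad) fun φ i => ?_
  have c1 := (φ.contDiff.fderiv_apply_const (EuclideanSpace.single i 1)).continuous
  have hc := φ.hasCompactSupport.fderiv_apply ℝ (EuclideanSpace.single i 1)
  have hs := (tsupport_fderiv_apply_subset φ (EuclideanSpace.single i 1)).trans φ.tsupport_subset
  have i1 := integrable_test_smul_of_tsupport_subset hu.locInt c1 hc hs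
  have i2 := integrable_test_smul_of_tsupport_subset hv.locInt c1 hc hs
  have i3 := integrable_test_smul_of_tsupport_subset (locallyIntegrableOn_coord hu.locInt_grad i)
    φ.continuous φ.hasCompactSupport φ.tsupport_subset
  have i4 := integrable_test_smul_of_tsupport_subset (locallyIntegrableOn_coord hv.locInt_grad i)
    φ.continuous φ.hasCompactSupport φ.tsupport_subset
  simp only [smul_eq_mul] at i1 i2 i3 i4
  simp_rw [PiLp.add_apply, mul_add]
  rw [integral_add i1 i2, integral_add i3 i4, hu.integral_fderiv_mul, hv.integral_fderiv_mul]
  ring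

theorem IsWeakGrad.isWeakGrad_weakGrad {u : Eu n → ℝ} {G : Eu n → Eu n} (h : IsWeakGrad U u G) :
    IsWeakGrad U u (weakGrad U u) := by
  have h' : ∃ G, IsWeakGrad U u G := ⟨G, h⟩
  rw [weakGrad, dif_pos h']
  exact h'.choose_spec

theorem MemH1.isWeakGrad {u : Eu n → ℝ} (h : MemH1 U u) : IsWeakGrad U u (weakGrad U u) :=
  h.exists_grad.choose_spec.1.isWeakGrad_weakGrad

theorem MemH1.memLp_weakGrad {u : Eu n → ℝ} (h : MemH1 U u) :
    MemLp (weakGrad U u) 2 (volume.restrict U) :=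
  (memLp_congr_ae h.exists_grad.choose_spec.1.weakGrad_ae_eq).2 h.exists_grad.choose_spec.2

/-- The product rule, obtained by using `φ χ` as test function on `U`; the values of `u` and `G` off
`U` are killed by `χ`. -/
theorem IsWeakGrad.hasWeakDeriv_cutoff {u : Eu n → ℝ} {G : Eu n → Eu n} (h : IsWeakGrad U u G)
    {χ : Eu n → ℝ} (hχ : ContDiff ℝ (⊤ : ℕ∞) χ) (hχc : HasCompactSupport χ) (hχU : tsupport χ ⊆ U)
    (i : Fin n) :
    HasWeakDeriv (fun x => χ x * u x)
      (fun x => (χ x • G x + u x • ∇ χ x) i) (EuclideanSpace.single i 1) := by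
  intro φ hφ hφc
  have h1 := h.integral_fderiv_mul ⟨fun x => φ x * χ x, hφ.mul hχ, hφc.mul_right,
    (tsupport_mul_subset_right).trans hχU⟩ i
  have h2 : ∀ x, fderiv ℝ (fun x => φ x * χ x) x (EuclideanSpace.single i 1) =
      φ x * fderiv ℝ χ x (EuclideanSpace.single i 1)
      + χ x * fderiv ℝ φ x (EuclideanSpace.single i 1) := fun x => by
    rw [fderiv_fun_mul (hφ.differentiable (by simp) x) (hχ.differentiable (by simp) x)]
    simp
  simp only [TestFunction.coe_mk, h2, add_mul] at h1
  have c1 := (hφ.fderiv_apply_const (EuclideanSpace.single i 1)).continuous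
  have c2 := (hχ.fderiv_apply_const (EuclideanSpace.single i 1)).continuous
  have i1 : Integrable fun x => φ x * fderiv ℝ χ x (EuclideanSpace.single i 1) * u x :=
    integrable_test_smul_of_tsupport_subset h.locInt (hφ.continuous.mul c2) hφc.mul_right
      ((tsupport_mul_subset_right).trans ((tsupport_fderiv_apply_subset _ _).trans hχU))
  have i2 : Integrable fun x => χ x * fderiv ℝ φ x (EuclideanSpace.single i 1) * u x :=
    integrable_test_smul_of_tsupport_subset h.locInt (hχ.continuous.mul c1) hχc.mul_right
      ((tsupport_mul_subset_left).trans hχU)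
  have i3 : Integrable fun x => φ x * χ x * G x i :=
    integrable_test_smul_of_tsupport_subset (locallyIntegrableOn_coord h.locInt_grad i)
      (hφ.continuous.mul hχ.continuous) hφc.mul_right ((tsupport_mul_subset_right).trans hχU)
  rw [integral_add i1 i2] at h1
  have e1 : ∫ x, φ x • (χ x • G x + u x • ∇ χ x) i =
      ∫ x, (φ x * χ x * G x i + φ x * fderiv ℝ χ x (EuclideanSpace.single i 1) * u x) := by
    congr 1
    ext x
    rw [← gradient_apply]
    simp
    ring
  have e2 : ∫ x, fderiv ℝ φ x (EuclideanSpace.single i 1) • (χ x * u x) =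
      ∫ x, χ x * fderiv ℝ φ x (EuclideanSpace.single i 1) * u x := by
    congr 1
    ext x
    simp
    ring
  rw [e1, e2, integral_add i3 i1]
  linarith

theorem memLp_smul_of_tsupport_subset {F : Type*} [NormedAddCommGroup F] [NormedSpace ℝ F]
    {f : Eu n → F} (hf : MemLp f 2 (volume.restrict (U : Set (Eu n)))) {φ : Eu n → ℝ}
    (hφ : Continuous φ) (hφc : HasCompactSupport φ) (hφU : tsupport φ ⊆ U) :
    MemLp (fun x => φ x • f x) 2 := by
  obtain ⟨B, hB⟩ := hφ.bounded_above_of_compact_support hφc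
  have h1 : MemLp (fun x => φ x • f x) 2 (volume.restrict (U : Set (Eu n))) :=
    hf.of_le_mul (hφ.aestronglyMeasurable.smul hf.1) (ae_of_all _ fun x => by
      rw [norm_smul]
      exact mul_le_mul_of_nonneg_right (hB x) (norm_nonneg _))
  rw [← memLp_indicator_iff_restrict U.isOpen.measurableSet] at h1
  refine (congrArg (MemLp · 2 volume) ?_).mp h1
  funext x
  by_cases hx : x ∈ (U : Set (Eu n))
  · exact Set.indicator_of_mem hx _
  · rw [Set.indicator_of_notMem hx, image_eq_zero_of_notMem_tsupport fun h => hx (hφU h), zero_smul]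

theorem memLp_smul_of_tsupport_subset' {f : Eu n → ℝ}
    (hf : MemLp f 2 (volume.restrict (U : Set (Eu n)))) {W : Eu n → Eu n}
    (hW : Continuous W) (hWc : HasCompactSupport W) (hWU : tsupport W ⊆ U) :
    MemLp (fun x => f x • W x) 2 := by
  obtain ⟨B, hB⟩ := hW.bounded_above_of_compact_support hWc
  have h1 : MemLp (fun x => f x • W x) 2 (volume.restrict (U : Set (Eu n))) :=
    hf.of_le_mul (c := B) (hf.1.smul hW.aestronglyMeasurable) (ae_of_all _ fun x => by
      rw [norm_smul, mul_comm]
      exact mul_le_mul_of_nonneg_right (hB x) (norm_nonneg _))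
  rw [← memLp_indicator_iff_restrict U.isOpen.measurableSet] at h1
  refine (congrArg (MemLp · 2 volume) ?_).mp h1
  funext x
  by_cases hx : x ∈ (U : Set (Eu n))
  · exact Set.indicator_of_mem hx _
  · rw [Set.indicator_of_notMem hx, image_eq_zero_of_notMem_tsupport fun h => hx (hWU h), smul_zero]

theorem integrable_inner_of_tsupport_subset {D W : Eu n → Eu n} (hD : LocallyIntegrableOn D U)
    (hW : Continuous W) (hWc : HasCompactSupport W) (hWU : tsupport W ⊆ U) :
    Integrable fun x => inner ℝ (D x) (W x) := by
  have h0 : tsupport (fun x => ‖W x‖) = tsupport W := by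
    rw [tsupport, tsupport]
    congr 1
    ext x
    simp
  have h1 := integrable_test_smul_of_tsupport_subset hD hW.norm hWc.norm (h0.trans_subset hWU)
  have hD' : IntegrableOn D (tsupport W) := hD.integrableOn_compact_subset hWU hWc
  have h2 : IntegrableOn (fun x => inner ℝ (D x) (W x)) (tsupport W) :=
    (h1.restrict (s := tsupport W)).mono (hD'.1.inner hW.aestronglyMeasurable) (ae_of_all _ fun x => by
      rw [norm_smul, norm_norm, mul_comm]
      exact norm_inner_le_norm _ _)
  refine (integrableOn_iff_integrable_of_support_subset ?_).1 h2
  intro x hx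
  refine subset_tsupport W fun h => hx ?_
  simp [h]

end Localization

/-! ### Part (i): the Euler–Lagrange equation. -/

section Minimisers

variable {n : ℕ} {U : Opens (Eu n)} {L : Eu n → ℝ}

theorem energy_eq_coe_integral {v : Eu n → ℝ} {G : Eu n → Eu n}
    (hvG : weakGrad U v =ᵐ[volume.restrict U] G) (hi : IntegrableOn (fun x => L (G x)) U) :
    energy U L v = ((∫ x in U, L (G x) : ℝ) : EReal) := by
  have e1 : ∫⁻ x in U, ENNReal.ofReal (L (weakGrad U v x)) =
      ∫⁻ x in U, ENNReal.ofReal (L (G x)) :=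
    lintegral_congr_ae (hvG.mono fun x hx => by simp only [hx])
  have e2 : ∫⁻ x in U, ENNReal.ofReal (-L (weakGrad U v x)) =
      ∫⁻ x in U, ENNReal.ofReal (-L (G x)) :=
    lintegral_congr_ae (hvG.mono fun x hx => by simp only [hx])
  have f1 : ∫⁻ x in U, ENNReal.ofReal (L (G x)) ≠ ∞ := hi.lintegral_lt_top.ne
  have f2 : ∫⁻ x in U, ENNReal.ofReal (-L (G x)) ≠ ∞ := hi.neg.lintegral_lt_top.ne
  rw [energy, e1, e2, if_neg f1, integral_eq_lintegral_pos_part_sub_lintegral_neg_part hi,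
    EReal.coe_sub, EReal.coe_ennreal_toReal f1, EReal.coe_ennreal_toReal f2]

/-- If the positive part has finite integral, an infinite negative part would make the energy `-∞`,
below the real number `a`. -/
theorem integrableOn_of_le_energy (hL : Continuous L) {v : Eu n → ℝ} {G : Eu n → Eu n}
    (hG : AEStronglyMeasurable G (volume.restrict U))
    (hvG : weakGrad U v =ᵐ[volume.restrict U] G)
    (hfin : ∫⁻ x in U, ENNReal.ofReal (L (G x)) ≠ ∞) {a : ℝ} (ha : (a : EReal) ≤ energy U L v) :
    IntegrableOn (fun x => L (G x)) U := by
  have e1 : ∫⁻ x in U, ENNReal.ofReal (L (weakGrad U v x)) =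
      ∫⁻ x in U, ENNReal.ofReal (L (G x)) :=
    lintegral_congr_ae (hvG.mono fun x hx => by simp only [hx])
  have e2 : ∫⁻ x in U, ENNReal.ofReal (-L (weakGrad U v x)) =
      ∫⁻ x in U, ENNReal.ofReal (-L (G x)) :=
    lintegral_congr_ae (hvG.mono fun x hx => by simp only [hx])
  rw [energy, e1, e2, if_neg hfin] at ha
  have f2 : ∫⁻ x in U, ENNReal.ofReal (-L (G x)) ≠ ∞ := by
    intro h
    rw [h, EReal.coe_ennreal_top, EReal.sub_top] at ha
    exact absurd ha (by simp)
  have hm : AEStronglyMeasurable (fun x => L (G x)) (volume.restrict U) :=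
    hL.comp_aestronglyMeasurable hG
  refine ⟨hm, ?_⟩
  rw [hasFiniteIntegral_iff_norm]
  have h1 : ∀ x, ENNReal.ofReal ‖L (G x)‖ ≤
      ENNReal.ofReal (L (G x)) + ENNReal.ofReal (-L (G x)) := fun x => by
    rcases le_total 0 (L (G x)) with h | h
    · rw [Real.norm_of_nonneg h]
      exact le_self_add
    · rw [Real.norm_of_nonpos h]
      exact le_add_self
  refine (lintegral_mono h1).trans_lt ?_
  rw [lintegral_add_left' hm.aemeasurable.ennreal_ofReal]
  exact ENNReal.add_lt_top.2 ⟨hfin.lt_top, f2.lt_top⟩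

theorem IsMinimiser.integrableOn_add_gradient (hL : ContDiff ℝ 2 L) {Λ : ℝ} (hΛ : 0 < Λ)
    (hU : HessianLE L Λ) {𝒜 : Set (Eu n → ℝ)} (h𝒜 : IsAdmissibleClass U 𝒜) {u : Eu n → ℝ}
    (hu : IsMinimiser U L 𝒜 u) (w : 𝓓(U, ℝ)) :
    IntegrableOn (fun x => L (weakGrad U u x + ∇ w x)) U ∧
      ∫ x in U, L (weakGrad U u x) ≤ ∫ x in U, L (weakGrad U u x + ∇ w x) := by
  have hu1 := h𝒜.memH1 u hu.mem
  set G := weakGrad U u with hGdef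
  have hG : MemLp G 2 (volume.restrict U) := hu1.memLp_weakGrad
  have hw : ContDiff ℝ (⊤ : ℕ∞) w := w.contDiff
  have hwL : MemLp (∇ w) 2 (volume.restrict (U : Set (Eu n))) :=
    (hw.continuous_gradient.memLp_of_hasCompactSupport
      w.hasCompactSupport.gradient).restrict _
  have hp : MemLp (fun x => G x + ∇ w x) 2 (volume.restrict U) := hG.add hwL
  have hv : weakGrad U (fun x => u x + w x) =ᵐ[volume.restrict U] fun x => G x + ∇ w x :=
    (hu1.isWeakGrad.add (isWeakGrad_test w)).weakGrad_ae_eq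
  have hEu : energy U L u = ((∫ x in U, L (G x) : ℝ) : EReal) :=
    energy_eq_coe_integral (EventuallyEq.refl _ _) hu.finite_energy
  have hle := hu.energy_le _ (h𝒜.add_test u hu.mem w)
  -- An integrable majorant. On the support of `w` it comes from Taylor's estimate at `0`; elsewhere
  -- `∇ w = 0` and the first term suffices. The constant is restricted to the support because `U`
  -- may have infinite measure.
  let B : Eu n → ℝ := fun x => ‖L (G x)‖ +
    ((tsupport w).indicator (fun _ => |L 0| + ‖∇ L 0‖ ^ 2 / 2) x +
      (1 / 2 + Λ / 2) * ‖G x + ∇ w x‖ ^ 2)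
  have hB : IntegrableOn B U := by
    refine hu.finite_energy.norm.add (Integrable.add ?_ ?_)
    · refine Integrable.restrict ?_
      rw [integrable_indicator_iff (isClosed_tsupport w).measurableSet]
      exact integrableOn_const (IsCompact.measure_lt_top w.hasCompactSupport).ne
    · exact (hp.integrable_norm_pow (p := 2) (by norm_num)).const_mul _
  have hLB : ∀ x, L (G x + ∇ w x) ≤ B x := fun x => by
    by_cases hx : x ∈ tsupport w
    · have h1 := hU.le_taylor hL 0 (G x + ∇ w x)
      have h2 := real_inner_le_norm (∇ L 0) (G x + ∇ w x)
      have h3 := le_abs_self (L 0)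
      have h4 : 0 ≤ ‖L (G x)‖ := norm_nonneg _
      have h5 := sq_nonneg (‖∇ L 0‖ - ‖G x + ∇ w x‖)
      simp only [B, Set.indicator_of_mem hx]
      rw [zero_add] at h1
      nlinarith
    · have h1 : ∇ w x = 0 := image_eq_zero_of_notMem_tsupport
        fun h => hx (tsupport_gradient_subset _ h)
      simp only [B, Set.indicator_of_notMem hx, h1, add_zero, zero_add]
      have h4 : L (G x) ≤ ‖L (G x)‖ := le_abs_self _
      have h5 : 0 ≤ (1 / 2 + Λ / 2) * ‖G x‖ ^ 2 := by positivity
      linarith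
  have hfin : ∫⁻ x in U, ENNReal.ofReal (L (G x + ∇ w x)) ≠ ∞ :=
    ((lintegral_mono fun x => ENNReal.ofReal_le_ofReal (hLB x)).trans_lt
      hB.lintegral_lt_top).ne
  have hint := integrableOn_of_le_energy hL.continuous hp.1 hv hfin (hEu ▸ hle)
  refine ⟨hint, ?_⟩
  rw [hEu, energy_eq_coe_integral hv hint] at hle
  exact_mod_cast hle

theorem IsMinimiser.integrableOn_add_const (hL : ContDiff ℝ 2 L) {Λ : ℝ} (hΛ : 0 < Λ)
    (hU : HessianLE L Λ) {𝒜 : Set (Eu n → ℝ)} (h𝒜 : IsAdmissibleClass U 𝒜) {u : Eu n → ℝ}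
    (hu : IsMinimiser U L 𝒜 u) (e : Eu n) {K : Set (Eu n)} (hK : IsCompact K) (hKU : K ⊆ U) :
    IntegrableOn (fun x => L (weakGrad U u x + e)) K := by
  obtain ⟨χ, hχ, hχc, hχU, hχ1⟩ := exists_cutoff hK U.isOpen hKU
  -- A cut-off linear function, whose gradient is `e` near `K`.
  let w : 𝓓(U, ℝ) := ⟨fun x => χ x * inner ℝ e x, hχ.mul (innerSL ℝ e).contDiff, hχc.mul_right,
    tsupport_mul_subset_left.trans hχU⟩
  have h1 := ((hu.integrableOn_add_gradient hL hΛ hU h𝒜 w).1).mono_set hKU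
  refine h1.congr_fun (fun x hx => ?_) hK.measurableSet
  have h2 : (w : Eu n → ℝ) =ᶠ[𝓝 x] fun x => inner ℝ e x := by
    filter_upwards [(eventually_nhdsSet_iff_forall.1 hχ1) x hx] with y hy
    change χ y * inner ℝ e y = _
    rw [hy, one_mul]
  have h3 : ∇ w x = e := by
    rw [gradient, h2.fderiv_eq]
    have : HasFDerivAt (fun x : Eu n => inner ℝ e x) (innerSL ℝ e) x :=
      (innerSL ℝ e).hasFDerivAt
    rw [this.fderiv]
    exact (InnerProductSpace.toDual ℝ (Eu n)).symm_apply_apply e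
  simp only [h3]

/-- Taylor's estimate in the directions `b i` and `-b i` bounds the `i`-th component of `∇L(∇u)`
from below and from above by values of `L` at `∇u` and `∇u ± b i`, all integrable on `K` by the
preceding lemma and the finite energy. -/
theorem IsMinimiser.locallyIntegrableOn_gradient (hL : ContDiff ℝ 2 L) {Λ : ℝ} (hΛ : 0 < Λ)
    (hU : HessianLE L Λ) {𝒜 : Set (Eu n → ℝ)} (h𝒜 : IsAdmissibleClass U 𝒜) {u : Eu n → ℝ}
    (hu : IsMinimiser U L 𝒜 u) : LocallyIntegrableOn (fun x => ∇ L (weakGrad U u x)) U := by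
  rw [locallyIntegrableOn_iff U.isOpen.isLocallyClosed]
  intro K hKU hK
  set G := weakGrad U u with hGdef
  have hG : MemLp G 2 (volume.restrict U) := (h𝒜.memH1 u hu.mem).memLp_weakGrad
  have hm : AEStronglyMeasurable (fun x => ∇ L (G x)) (volume.restrict K) :=
    (contDiff_gradient hL).continuous.comp_aestronglyMeasurable
      (hG.1.mono_measure (Measure.restrict_mono_set _ hKU))
  let b : Fin n → Eu n := fun i => EuclideanSpace.single i 1
  have hi : ∀ e : Eu n, IntegrableOn (fun x => L (G x + e)) K := fun e =>
    hu.integrableOn_add_const hL hΛ hU h𝒜 e hK hKU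
  have hi0 : IntegrableOn (fun x => L (G x)) K := hu.finite_energy.mono_set hKU
  have hB : IntegrableOn (fun x => ∑ i : Fin n,
      (‖L (G x + b i)‖ + ‖L (G x + -b i)‖ + ‖L (G x)‖ + Λ / 2)) K := by
    refine integrable_finsetSum _ fun i _ => ?_
    exact (((hi _).norm.add (hi _).norm).add hi0.norm).add
      (integrableOn_const hK.measure_lt_top.ne)
  refine hB.mono' hm (ae_of_all _ fun x => ?_)
  have hsum : ‖∇ L (G x)‖ ≤ ∑ i, |∇ L (G x) i| := by
    have h1 : ∇ L (G x) = ∑ i, (∇ L (G x) i) • b i := by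
      have := (EuclideanSpace.basisFun (Fin n) ℝ).sum_repr (∇ L (G x))
      simpa [b] using this.symm
    conv_lhs => rw [h1]
    refine (norm_sum_le _ _).trans_eq (Finset.sum_congr rfl fun i _ => ?_)
    rw [norm_smul]
    simp [b]
  refine hsum.trans (Finset.sum_le_sum fun i _ => ?_)
  have hb : ‖b i‖ = 1 := by simp [b]
  have hin : inner ℝ (∇ L (G x)) (b i) = ∇ L (G x) i := by
    simp [b, -inner_gradient_left, EuclideanSpace.inner_single_right]
  have t1 := hU.le_taylor hL (G x) (b i)
  have t2 := hU.le_taylor hL (G x) (-b i)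
  rw [inner_neg_right, norm_neg, hin, hb] at t2
  rw [hin, hb] at t1
  have a1 := neg_abs_le (L (G x + b i))
  have a2 := neg_abs_le (L (G x + -b i))
  have a3 := le_abs_self (L (G x))
  have a4 := abs_nonneg (L (G x + b i))
  have a5 := abs_nonneg (L (G x + -b i))
  simp only [Real.norm_eq_abs]
  rw [abs_le]
  constructor <;> linarith

theorem IsMinimiser.isWeakSolEL (hL : ContDiff ℝ 2 L) {Λ : ℝ} (hΛ : 0 < Λ)
    (hU : HessianLE L Λ) {𝒜 : Set (Eu n → ℝ)} (h𝒜 : IsAdmissibleClass U 𝒜) {u : Eu n → ℝ}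
    (hu : IsMinimiser U L 𝒜 u) : IsWeakSolEL U L u := by
  have hloc := hu.locallyIntegrableOn_gradient hL hΛ hU h𝒜
  refine ⟨h𝒜.memH1 u hu.mem, hloc, fun w => ?_⟩
  set G := weakGrad U u with hGdef
  have hw : ContDiff ℝ (⊤ : ℕ∞) w := w.contDiff
  have hi1 : IntegrableOn (fun x => inner ℝ (∇ L (G x)) (∇ w x)) U :=
    (integrable_inner_of_tsupport_subset hloc hw.continuous_gradient
      w.hasCompactSupport.gradient
      ((tsupport_gradient_subset _).trans w.tsupport_subset)).restrict
  have hi2 : IntegrableOn (fun x => ‖∇ w x‖ ^ 2) U :=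
    ((hw.continuous_gradient.memLp_of_hasCompactSupport (p := 2)
      w.hasCompactSupport.gradient).integrable_norm_pow (p := 2) (by norm_num)).restrict
  set I := ∫ x in U, inner ℝ (∇ L (G x)) (∇ w x) with hI
  set B := ∫ x in U, ‖∇ w x‖ ^ 2 with hB
  have hi0 : IntegrableOn (fun x => L (G x)) U := hu.finite_energy
  have key : ∀ s : ℝ, 0 ≤ (Λ / 2 * B) * (s * s) + I * s + 0 := fun s => by
    obtain ⟨h1, h2⟩ := hu.integrableOn_add_gradient hL hΛ hU h𝒜 (s • w)
    have hs : ∀ x, ∇ (s • w : 𝓓(U, ℝ)) x = s • ∇ w x := fun x => by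
      have : fderiv ℝ (⇑(s • w)) x = s • fderiv ℝ w x :=
        fderiv_const_smul (hw.differentiable (by simp) x) s
      rw [gradient, this, gradient]
      simp
    simp_rw [hs] at h1 h2
    have hi3 : IntegrableOn (fun x => L (G x) + s * inner ℝ (∇ L (G x)) (∇ w x)) U :=
      hi0.add (hi1.const_mul s)
    have h3 : ∫ x in U, L (G x + s • ∇ w x) ≤
        ∫ x in U, (L (G x) + s * inner ℝ (∇ L (G x)) (∇ w x) +
          Λ / 2 * s ^ 2 * ‖∇ w x‖ ^ 2) := by
      refine integral_mono h1
        (hi3.add (hi2.const_mul (Λ / 2 * s ^ 2))) fun x => ?_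
      refine (hU.le_taylor hL (G x) (s • ∇ w x)).trans_eq ?_
      rw [inner_smul_right, norm_smul, mul_pow, Real.norm_eq_abs, sq_abs]
      ring
    rw [integral_add hi3 (hi2.const_mul (Λ / 2 * s ^ 2)), integral_add hi0 (hi1.const_mul s), integral_const_mul, integral_const_mul]
      at h3
    nlinarith
  -- The constant term is zero, so the discriminant is `I ^ 2`.
  have := discrim_le_zero key
  rw [discrim, mul_zero, sub_zero] at this
  exact pow_eq_zero_iff two_ne_zero |>.1 (le_antisymm this (sq_nonneg I))

end Minimisers

/-! ### The chain rule and integration by parts for weak derivatives. -/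

section ChainRule

variable {n : ℕ}

theorem locallyIntegrable_coord {m : ℕ} {G : Eu n → Eu m} (hG : LocallyIntegrable G) (i : Fin m) :
    LocallyIntegrable fun x => G x i := fun x => by
  obtain ⟨t, ht, h⟩ := hG x
  exact ⟨t, ht, (EuclideanSpace.proj (𝕜 := ℝ) i).integrable_comp h⟩

theorem memLp_coord {m : ℕ} {μ : Measure (Eu n)} {G : Eu n → Eu m} (hG : MemLp G 2 μ) (i : Fin m) :
    MemLp (fun x => G x i) 2 μ :=
  hG.continuousLinearMap_comp (EuclideanSpace.proj (𝕜 := ℝ) i)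

theorem memLp_clm_apply {F : Type*} [NormedAddCommGroup F] [NormedSpace ℝ F]
    {μ : Measure (Eu n)} {A : Eu n → Eu n →L[ℝ] F} (hA : Continuous A)
    {M : ℝ} (hM : ∀ p, ‖A p‖ ≤ M) {γ κ : Eu n → Eu n} (hγ : AEStronglyMeasurable γ μ)
    (hκ : MemLp κ 2 μ) : MemLp (fun x => A (γ x) (κ x)) 2 μ :=
  hκ.of_le_mul (isBoundedBilinearMap_apply.continuous.comp_aestronglyMeasurable
    ((hA.comp_aestronglyMeasurable hγ).prodMk hκ.1)) (ae_of_all _ fun _ =>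
      (ContinuousLinearMap.le_opNorm _ _).trans
        (mul_le_mul_of_nonneg_right (hM _) (norm_nonneg _)))

theorem tendsto_eLpNorm_zero_of_le {F F' : Type*} [NormedAddCommGroup F] [NormedAddCommGroup F']
    {f : ℕ → Eu n → F} {g : ℕ → Eu n → F'} {M : ℝ} (h : ∀ k x, ‖f k x‖ ≤ M * ‖g k x‖)
    (hg : Tendsto (fun k => eLpNorm (g k) 2) atTop (𝓝 0)) :
    Tendsto (fun k => eLpNorm (f k) 2) atTop (𝓝 0) := by
  have h1 : Tendsto (fun k => ENNReal.ofReal M * eLpNorm (g k) 2) atTop (𝓝 0) := by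
    simpa using ENNReal.Tendsto.const_mul hg (Or.inr ENNReal.ofReal_ne_top)
  exact tendsto_of_tendsto_of_tendsto_of_le_of_le tendsto_const_nhds h1 (fun _ => zero_le)
    fun k => eLpNorm_le_mul_eLpNorm_of_ae_le_mul (ae_of_all _ (h k)) 2

theorem HasWeakDeriv.congr {F : Type*} [NormedAddCommGroup F] [NormedSpace ℝ F]
    {v f v' f' : Eu n → F} {e : Eu n} (h : HasWeakDeriv v f e) (hv : v =ᵐ[volume] v')
    (hf : f =ᵐ[volume] f') : HasWeakDeriv v' f' e := by
  intro φ hφ hφc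
  rw [← integral_congr_ae (hf.mono fun x hx => show φ x • f x = φ x • f' x by rw [hx]),
    ← integral_congr_ae (hv.mono fun x hx =>
      show fderiv ℝ φ x e • v x = fderiv ℝ φ x e • v' x by rw [hx])]
  exact h φ hφ hφc

theorem hasWeakDeriv_of_coord {m : ℕ} {v f : Eu n → Eu m} {e : Eu n} (hv : LocallyIntegrable v)
    (hf : LocallyIntegrable f)
    (h : ∀ i, HasWeakDeriv (fun x => v x i) (fun x => f x i) e) : HasWeakDeriv v f e := by
  intro φ hφ hφc
  ext i
  have i1 := hv.integrable_test_smul (hφ.fderiv_apply_const e).continuous (hφc.fderiv_apply ℝ e)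
  have i2 := hf.integrable_test_smul hφ.continuous hφc
  have h1 := (EuclideanSpace.proj (𝕜 := ℝ) i).integral_comp_comm i1
  have h2 := (EuclideanSpace.proj (𝕜 := ℝ) i).integral_comp_comm i2
  have h3 := h i φ hφ hφc
  simp only [EuclideanSpace.coe_proj, PiLp.smul_apply] at h1 h2
  rw [PiLp.neg_apply, ← h1, ← h2]
  exact h3

/-- The chain rule for a `C¹` function with bounded derivative. -/
theorem HasWeakDeriv.comp {Φ : Eu n → ℝ} (hΦ : ContDiff ℝ 1 Φ) {M : ℝ}
    (hM : ∀ p, ‖fderiv ℝ Φ p‖ ≤ M) {γ κ : Eu n → Eu n} {e : Eu n} (hγ : MemLp γ 2)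
    (hκ : MemLp κ 2) (h : HasWeakDeriv γ κ e) :
    HasWeakDeriv (fun x => Φ (γ x)) (fun x => fderiv ℝ Φ (γ x) (κ x)) e := by
  intro φ hφ hφc
  have hγl : LocallyIntegrable γ := hγ.locallyIntegrable (by norm_num)
  have hΦ' : Continuous (fderiv ℝ Φ) := hΦ.continuous_fderiv (by simp)
  have hlip : ∀ p q, ‖Φ p - Φ q‖ ≤ M * ‖p - q‖ := fun p q =>
    Convex.norm_image_sub_le_of_norm_fderiv_le (s := Set.univ)
      (fun x _ => hΦ.differentiable (by simp) x) (fun x _ => hM x) convex_univ trivial trivial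
  let γs : ℕ → Eu n → Eu n := fun k => moll (bumpSeq n k) γ
  let κs : ℕ → Eu n → Eu n := fun k => moll (bumpSeq n k) κ
  have hγs : ∀ k, ContDiff ℝ (⊤ : ℕ∞) (γs k) := fun k => contDiff_moll _ hγl
  have hγsL : ∀ k, MemLp (γs k) 2 := fun k => memLp_moll _ hγ
  have hκsL : ∀ k, MemLp (κs k) 2 := fun k => memLp_moll _ hκ
  have cφ := (hφ.fderiv_apply_const e).continuous
  have dφc := hφc.fderiv_apply ℝ e
  have hφL : MemLp φ 2 := hφ.continuous.memLp_of_hasCompactSupport hφc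
  have hdφL : MemLp (fun x => fderiv ℝ φ x e) 2 := cφ.memLp_of_hasCompactSupport dφc
  have hsmooth : ∀ k, ∫ x, fderiv ℝ φ x e • Φ (γs k x) =
      - ∫ x, φ x • fderiv ℝ Φ (γs k x) (κs k x) := fun k => by
    have hc : ContDiff ℝ 1 fun x => Φ (γs k x) :=
      hΦ.comp ((hγs k).of_le (by exact_mod_cast le_top))
    have hd : ∀ x, fderiv ℝ (fun x => Φ (γs k x)) x e = fderiv ℝ Φ (γs k x) (κs k x) := fun x => by
      have h1 : HasFDerivAt (fun x => Φ (γs k x))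
          ((fderiv ℝ Φ (γs k x)).comp (fderiv ℝ (γs k) x)) x :=
        (hΦ.differentiable (by simp) _).hasFDerivAt.comp x
          ((hγs k).differentiable (by simp) x).hasFDerivAt
      rw [h1.fderiv, ContinuousLinearMap.comp_apply, h.fderiv_moll hγl]
    have hcd : Continuous fun x => fderiv ℝ (fun x => Φ (γs k x)) x e :=
      (hc.continuous_fderiv (by simp)).clm_apply continuous_const
    have h1 := integral_mul_fderiv_eq_neg_fderiv_mul_of_integrable (μ := volume)
      (f := φ) (g := fun x => Φ (γs k x)) (v := e)
      ((cφ.mul hc.continuous).integrable_of_hasCompactSupport dφc.mul_right)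
      ((hφ.continuous.mul hcd).integrable_of_hasCompactSupport hφc.mul_right)
      ((hφ.continuous.mul hc.continuous).integrable_of_hasCompactSupport hφc.mul_right)
      (fun x _ => hφ.differentiable (by simp) x)
      (fun x _ => hc.differentiable (by simp) x)
    simp_rw [hd] at h1
    simp_rw [smul_eq_mul]
    rw [h1, neg_neg]
  have hγt := tendsto_eLpNorm_moll_sub (tendsto_bumpSeq_rOut n) hγ
  have hκt := tendsto_eLpNorm_moll_sub (tendsto_bumpSeq_rOut n) hκ
  have hlimL : Tendsto (fun k => ∫ x, fderiv ℝ φ x e • Φ (γs k x)) atTop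
      (𝓝 (∫ x, fderiv ℝ φ x e • Φ (γ x))) := by
    -- Only differences are placed in `L²`: `Φ ∘ γ` need not be there when `Φ 0 ≠ 0`.
    have hDL : ∀ k, MemLp (fun x => Φ (γs k x) - Φ (γ x)) 2 := fun k =>
      ((hγsL k).sub hγ).of_le_mul
        ((hΦ.continuous.comp_aestronglyMeasurable (hγsL k).1).sub
          (hΦ.continuous.comp_aestronglyMeasurable hγ.1)) (ae_of_all _ fun x => hlip _ _)
    have hD : Tendsto (fun k => eLpNorm (fun x => (Φ (γs k x) - Φ (γ x)) - 0) 2) atTop (𝓝 0) :=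
      tendsto_eLpNorm_zero_of_le (fun k x => by simpa using hlip _ _) hγt
    have h1 := tendsto_integral_inner hdφL hDL MemLp.zero' hD
    have hl : LocallyIntegrable fun x => Φ (γ x) := by
      have h2 : MemLp (fun x => Φ (γ x) - Φ 0) 2 :=
        hγ.of_le_mul ((hΦ.continuous.comp_aestronglyMeasurable hγ.1).sub
          aestronglyMeasurable_const) (ae_of_all _ fun x => by simpa using hlip (γ x) 0)
      refine ((h2.locallyIntegrable (by norm_num)).add
        (locallyIntegrable_const (μ := (volume : Measure (Eu n))) (Φ 0))).congr
        (ae_of_all _ fun x => ?_)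
      simp
    have i1 := hl.integrable_test_smul cφ dφc
    have i2 : ∀ k, Integrable fun x => fderiv ℝ φ x e • Φ (γs k x) := fun k =>
      (hΦ.continuous.comp (hγs k).continuous).locallyIntegrable.integrable_test_smul cφ dφc
    rw [← tendsto_sub_nhds_zero_iff]
    have h3 : ∀ k, ∫ x, inner ℝ (fderiv ℝ φ x e) (Φ (γs k x) - Φ (γ x)) =
        (∫ x, fderiv ℝ φ x e • Φ (γs k x)) - ∫ x, fderiv ℝ φ x e • Φ (γ x) := fun k => by
      rw [← integral_sub (i2 k) i1]
      congr 1
      ext x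
      simp
      ring
    simp_rw [h3] at h1
    simpa using h1
  have hlimR : Tendsto (fun k => ∫ x, φ x • fderiv ℝ Φ (γs k x) (κs k x)) atTop
      (𝓝 (∫ x, φ x • fderiv ℝ Φ (γ x) (κ x))) := by
    -- Split off `κs k - κ`, which tends to zero in `L²` against a bounded factor. The rest has `κ`
    -- fixed and needs only a.e. convergence of `γs k`, as `fderiv ℝ Φ` is merely continuous.
    have hEL : ∀ k, MemLp (fun x => fderiv ℝ Φ (γs k x) (κs k x - κ x)) 2 := fun k =>
      memLp_clm_apply hΦ' hM (hγsL k).1 ((hκsL k).sub hκ)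
    have hE : Tendsto (fun k => eLpNorm
        (fun x => fderiv ℝ Φ (γs k x) (κs k x - κ x) - 0) 2) atTop (𝓝 0) :=
      tendsto_eLpNorm_zero_of_le (M := M) (fun k x => by
        rw [sub_zero]
        exact (ContinuousLinearMap.le_opNorm _ _).trans
          (mul_le_mul_of_nonneg_right (hM _) (norm_nonneg _))) hκt
    have h1 := tendsto_integral_inner hφL hEL MemLp.zero' hE
    have hA : ∀ k, MemLp (fun x => fderiv ℝ Φ (γs k x) (κ x)) 2 := fun k =>
      memLp_clm_apply hΦ' hM (hγsL k).1 hκ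
    have h2 : Tendsto (fun k => ∫ x, inner ℝ (φ x) (fderiv ℝ Φ (γs k x) (κ x))) atTop
        (𝓝 (∫ x, inner ℝ (φ x) (fderiv ℝ Φ (γ x) (κ x)))) := by
      refine tendsto_integral_of_dominated_convergence (fun x => M * (‖φ x‖ * ‖κ x‖))
        (fun k => (integrable_inner_of_memLp hφL (hA k)).1)
        ((hφL.norm.integrable_mul hκ.norm).const_mul M) (fun k => ae_of_all _ fun x => ?_) ?_
      · refine (norm_inner_le_norm _ _).trans ?_
        have := (ContinuousLinearMap.le_opNorm (fderiv ℝ Φ (γs k x)) (κ x)).trans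
          (mul_le_mul_of_nonneg_right (hM _) (norm_nonneg _))
        calc _ ≤ ‖φ x‖ * (M * ‖κ x‖) := mul_le_mul_of_nonneg_left this (norm_nonneg _)
          _ = _ := by ring
      · filter_upwards [ae_tendsto_moll hγl] with x hx
        have h3 : Tendsto (fun k => fderiv ℝ Φ (γs k x) (κ x)) atTop
            (𝓝 (fderiv ℝ Φ (γ x) (κ x))) :=
          ((hΦ'.clm_apply continuous_const).tendsto (γ x)).comp hx
        exact tendsto_const_nhds.inner h3
    have h3 := h1.add h2
    simp only [inner_zero_right, integral_zero, zero_add] at h3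
    have e1 : ∀ k, (∫ x, inner ℝ (φ x) (fderiv ℝ Φ (γs k x) (κs k x - κ x))) +
        ∫ x, inner ℝ (φ x) (fderiv ℝ Φ (γs k x) (κ x)) =
        ∫ x, φ x • fderiv ℝ Φ (γs k x) (κs k x) := fun k => by
      rw [← integral_add (integrable_inner_of_memLp hφL (hEL k))
        (integrable_inner_of_memLp hφL (hA k))]
      congr 1
      ext x
      rw [← inner_add_right, ← map_add, sub_add_cancel]
      simp [mul_comm]
    simp_rw [e1] at h3
    convert h3 using 3
    ext x
    simp [mul_comm]
  exact tendsto_nhds_unique hlimL ((hlimR.neg).congr fun k => (hsmooth k).symm)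

theorem integral_inner_fderiv_eq_neg {v f : Eu n → Eu n} {e : Eu n} (hv : LocallyIntegrable v)
    (hf : LocallyIntegrable f)
    (h : ∀ i, HasWeakDeriv (fun x => v x i) (fun x => f x i) e) {W : Eu n → Eu n}
    (hW : ContDiff ℝ (⊤ : ℕ∞) W) (hWc : HasCompactSupport W) :
    ∫ x, inner ℝ (v x) (fderiv ℝ W x e) = - ∫ x, inner ℝ (f x) (W x) := by
  have hWi : ∀ i, ContDiff ℝ (⊤ : ℕ∞) fun x => W x i := fun i =>
    (EuclideanSpace.proj (𝕜 := ℝ) i).contDiff.comp hW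
  have hWci : ∀ i, HasCompactSupport fun x => W x i := fun i =>
    hWc.comp_left (g := fun p : Eu n => p i) (by simp)
  have hd : ∀ x i, (fderiv ℝ W x e) i = fderiv ℝ (fun x => W x i) x e := fun x i => by
    have h1 : HasFDerivAt (fun x => W x i)
        ((EuclideanSpace.proj (𝕜 := ℝ) i).comp (fderiv ℝ W x)) x :=
      (EuclideanSpace.proj (𝕜 := ℝ) i).hasFDerivAt.comp x
        (hW.differentiable (by simp) x).hasFDerivAt
    rw [h1.fderiv]
    simp
  have e1 : ∀ x, inner ℝ (v x) (fderiv ℝ W x e) =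
      ∑ i, fderiv ℝ (fun x => W x i) x e • v x i := fun x => by
    rw [PiLp.inner_apply]
    simp [hd]
  have e2 : ∀ x, inner ℝ (f x) (W x) = ∑ i, W x i • f x i := fun x => by
    rw [PiLp.inner_apply]
    simp
  simp_rw [e1, e2]
  rw [integral_finsetSum _ fun i _ => (locallyIntegrable_coord hv i).integrable_test_smul
      ((hWi i).fderiv_apply_const e).continuous ((hWci i).fderiv_apply ℝ e),
    integral_finsetSum _ fun i _ => (locallyIntegrable_coord hf i).integrable_test_smul
      (hWi i).continuous (hWci i), ← Finset.sum_neg_distrib]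
  exact Finset.sum_congr rfl fun i _ => h i _ (hWi i) (hWci i)

end ChainRule

/-! ### Part (ii): second derivatives and the linearised equation. -/

section Regularity

variable {n : ℕ} {U V : Opens (Eu n)}

theorem IsWeakGrad.congr {u u' : Eu n → ℝ} {G : Eu n → Eu n} (h : IsWeakGrad U u G)
    (huu' : u =ᵐ[volume.restrict U] u') : IsWeakGrad U u' G := by
  refine ⟨?_, h.locInt_grad, fun φ i => ?_⟩
  · rw [locallyIntegrableOn_iff U.isOpen.isLocallyClosed]
    intro K hKU hK
    exact (h.locInt.integrableOn_compact_subset hKU hK).congr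
      (ae_mono (Measure.restrict_mono_set _ hKU) huu')
  · rw [← h.integral_eq φ i]
    exact integral_congr_ae (huu'.mono fun x hx => by simp only [hx])

theorem MemH1.congr {u u' : Eu n → ℝ} (h : MemH1 U u) (huu' : u =ᵐ[volume.restrict U] u') :
    MemH1 U u' := by
  obtain ⟨G, hG, hGL⟩ := h.exists_grad
  exact ⟨(memLp_congr_ae huu').1 h.memLp, G, hG.congr huu', hGL⟩

theorem gradient_eq_zero_of_eventually_one {χ : Eu n → ℝ} {x : Eu n} (h : ∀ᶠ y in 𝓝 x, χ y = 1) :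
    ∇ χ x = 0 := by
  have h1 : χ =ᶠ[𝓝 x] fun _ => (1 : ℝ) := h
  rw [gradient, h1.fderiv_eq]
  simp

/-- The partial derivative of a test function, as a test function. -/
noncomputable def partialTest (φ : 𝓓(V, ℝ)) (i : Fin n) : 𝓓(V, ℝ) :=
  ⟨fun x => fderiv ℝ φ x (EuclideanSpace.single i 1), φ.contDiff.fderiv_apply_const _,
    φ.hasCompactSupport.fderiv_apply ℝ _,
    (tsupport_fderiv_apply_subset φ _).trans φ.tsupport_subset⟩

theorem hessian_apply_single_apply {w : Eu n → ℝ} (hw : ContDiff ℝ (⊤ : ℕ∞) w) (x : Eu n)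
    (i : Fin n) : fderiv ℝ (∇ w) x (EuclideanSpace.single i 1) =
      ∇ (fun y => fderiv ℝ w y (EuclideanSpace.single i 1)) x := by
  have hw2 : ContDiff ℝ 2 w := contDiff_infty.1 hw 2
  ext m
  have h1 : (fderiv ℝ (∇ w) x (EuclideanSpace.single i 1)) m =
      inner ℝ (hessian w x (EuclideanSpace.single i 1)) (EuclideanSpace.single m 1) := by
    rw [EuclideanSpace.inner_single_right]
    simp [hessian]
  have h2 : HasFDerivAt (fun y => (∇ w y) i)
      ((EuclideanSpace.proj (𝕜 := ℝ) i).comp (hessian w x)) x :=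
    (EuclideanSpace.proj (𝕜 := ℝ) i).hasFDerivAt.comp x (hasFDerivAt_gradient hw2 x)
  have h3 : (fun y => fderiv ℝ w y (EuclideanSpace.single i 1)) = fun y => (∇ w y) i :=
    funext fun y => (gradient_apply w y i).symm
  rw [h1, inner_hessian_comm hw2, h3, gradient_apply, h2.fderiv, EuclideanSpace.inner_single_right]
  simp

/-- Two integrations by parts put both derivatives on the test function, where they commute. This
identifies `∂ᵢ(∇u)`, produced by the chain rule, with `∇(∂ᵢu)`, present in the linear equation. -/
theorem IsWeakGrad.partial_comm {u : Eu n → ℝ} {G : Eu n → Eu n} {H : Fin n → Eu n → Eu n}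
    (hu : IsWeakGrad V u G) (hG : ∀ i, IsWeakGrad V (fun x => G x i) (H i)) (i m : Fin n) :
    (fun x => H i x m) =ᵐ[volume.restrict V] fun x => H m x i := by
  have hint : ∀ (a b : Fin n) (φ : 𝓓(V, ℝ)), ∫ x, φ x * H a x b =
      ∫ x, fderiv ℝ (fun y => fderiv ℝ φ y (EuclideanSpace.single b 1)) x
        (EuclideanSpace.single a 1) * u x := fun a b φ => by
    have h1 := (hG a).integral_fderiv_mul φ b
    have h2 := hu.integral_fderiv_mul (partialTest φ b) a
    have h3 : ∫ x, partialTest φ b x * G x a =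
        ∫ x, fderiv ℝ φ x (EuclideanSpace.single b 1) * G x a := rfl
    have h4 : ∫ x, fderiv ℝ (partialTest φ b) x (EuclideanSpace.single a 1) * u x =
      ∫ x, fderiv ℝ (fun y => fderiv ℝ φ y (EuclideanSpace.single b 1)) x
        (EuclideanSpace.single a 1) * u x := rfl
    rw [← h4, h2, h3, h1, neg_neg]
  have hsymm : ∀ (φ : 𝓓(V, ℝ)) x, fderiv ℝ (fun y => fderiv ℝ φ y (EuclideanSpace.single m 1)) x
        (EuclideanSpace.single i 1) = fderiv ℝ (fun y => fderiv ℝ φ y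
        (EuclideanSpace.single i 1)) x (EuclideanSpace.single m 1) := fun φ x => by
    have hφ : ContDiff ℝ (⊤ : ℕ∞) φ := φ.contDiff
    have hφ2 : ContDiff ℝ 2 φ := contDiff_infty.1 hφ 2
    rw [← gradient_apply, ← gradient_apply, ← hessian_apply_single_apply hφ,
      ← hessian_apply_single_apply hφ]
    have := inner_hessian_comm hφ2 x (EuclideanSpace.single i 1) (EuclideanSpace.single m 1)
    rw [EuclideanSpace.inner_single_right, EuclideanSpace.inner_single_right] at this
    simpa [hessian] using this.symm
  have l1 := locallyIntegrableOn_coord (hG i).locInt_grad m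
  have l2 := locallyIntegrableOn_coord (hG m).locInt_grad i
  have key : ∀ᵐ x, x ∈ (V : Set (Eu n)) → H i x m - H m x i = 0 := by
    refine V.isOpen.ae_eq_zero_of_integral_contDiff_smul_eq_zero (l1.sub l2) fun g hg hgc hgs => ?_
    let φ : 𝓓(V, ℝ) := ⟨g, hg, hgc, hgs⟩
    have i1 := integrable_test_smul_of_tsupport_subset l1 hg.continuous hgc hgs
    have i2 := integrable_test_smul_of_tsupport_subset l2 hg.continuous hgc hgs
    have h1 : ∫ x, g x • H i x m = ∫ x, g x • H m x i := by
      refine (hint i m φ).trans (Eq.trans ?_ (hint m i φ).symm)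
      simp_rw [hsymm φ]
    change ∫ x, g x • (H i x m - H m x i) = 0
    simp_rw [smul_sub]
    rw [integral_sub i1 i2, h1, sub_self]
  rw [EventuallyEq, ae_restrict_iff' V.isOpen.measurableSet]
  filter_upwards [key] with x hx hxV
  exact sub_eq_zero.1 (hx hxV)

variable {L : Eu n → ℝ}

theorem eLpNorm_smul_translate_sub_le (hL : ContDiff ℝ 2 L) {Λ lam : ℝ} (hΛ : 0 < Λ)
    (hlam : 0 < lam) (hU : HessianLE L Λ) (hG : HessianGE L lam) {v : Eu n → ℝ}
    {g : Eu n → Eu n} (hv : MemLp v 2) (hg : MemLp g 2)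
    (hvg : ∀ i, HasWeakDeriv v (fun x => g x i) (EuclideanSpace.single i 1)) {O : Set (Eu n)}
    (hdiv : ∀ w : Eu n → ℝ, ContDiff ℝ (⊤ : ℕ∞) w → HasCompactSupport w → tsupport w ⊆ O →
      ∫ x, inner ℝ (∇ L (g x)) (∇ w x) = 0)
    {η : Eu n → ℝ} (hη : ContDiff ℝ (⊤ : ℕ∞) η) (hηc : HasCompactSupport η)
    {δ : ℝ} (hδ : 0 < δ) (hδO : Metric.thickening δ (tsupport η) ⊆ O)
    {M : ℝ} (hM : ∀ x, ‖∇ η x‖ ≤ M) (k : Fin n) {t : ℝ} (ht : |t| < δ / 2) :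
    (eLpNorm (fun x => η x •
      (g (x + t • (EuclideanSpace.single k 1 : Eu n)) - g x)) 2).toReal ≤
        2 * Λ * M / lam * (eLpNorm (fun x => g x k) 2).toReal * |t| := by
  set e : Eu n := EuclideanSpace.single k 1 with he
  have hM0 : 0 ≤ M := (norm_nonneg _).trans (hM 0)
  have hgk := memLp_coord hg k
  have hmp := measurePreserving_add_right (volume : Measure (Eu n)) (t • e)
  have hte : ‖t • e‖ < δ / 2 := by
    rw [norm_smul, Real.norm_eq_abs]
    simpa [he] using ht
  -- Half of `δ` is room around the support of `η`, the other half room for the translation.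
  have hcac := caccioppoli hL hΛ hlam hU hG hv hg hvg (O := O)
    (N := Metric.thickening (δ / 2) (tsupport η)) Metric.isOpen_thickening hdiv hη hηc
    (Metric.self_subset_thickening (by positivity) _) hM (h := t • e)
    ((Metric.thickening_mono (by linarith) _).trans hδO) (fun x hx => hδO (by
      rw [Metric.mem_thickening_iff] at hx ⊢
      obtain ⟨z, hz, hxz⟩ := hx
      refine ⟨z, hz, ?_⟩
      calc dist (x + t • e) z ≤ dist (x + t • e) x + dist x z := dist_triangle _ _ _
        _ < δ / 2 + δ / 2 := add_lt_add (by simpa [dist_eq_norm] using hte) hxz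
        _ = δ := by ring))
  have hηP : MemLp (fun x => η x • (g (x + t • e) - g x)) 2 :=
    memLp_smul_of_tsupport_subset (U := ⊤) (((hg.comp_measurePreserving hmp).sub hg).restrict _)
      hη.continuous hηc (by simp)
  have hqL : MemLp (fun x => v (x + t • e) - v x) 2 := (hv.comp_measurePreserving hmp).sub hv
  have hq2 : ∫ x, (v (x + t • e) - v x) ^ 2 ≤
      (|t| * (eLpNorm (fun x => g x k) 2).toReal) ^ 2 := by
    have h1 := toReal_eLpNorm_sq hqL
    simp only [Real.norm_eq_abs, sq_abs] at h1
    rw [← h1]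
    refine pow_le_pow_left₀ ENNReal.toReal_nonneg ?_ 2
    exact ENNReal.toReal_le_of_le_ofReal (by positivity)
      ((hvg k).eLpNorm_translate_sub_le hv hgk t)
  refine (pow_le_pow_iff_left₀ ENNReal.toReal_nonneg (by positivity) two_ne_zero).1 ?_
  rw [toReal_eLpNorm_sq hηP]
  have h1 : ∀ x, ‖η x • (g (x + t • e) - g x)‖ ^ 2 = (η x * ‖g (x + t • e) - g x‖) ^ 2 :=
    fun x => by rw [norm_smul, mul_pow, mul_pow, Real.norm_eq_abs, sq_abs]
  simp_rw [h1]
  refine hcac.trans ((mul_le_mul_of_nonneg_left hq2 (sq_nonneg _)).trans_eq ?_)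
  ring

theorem exists_weakDeriv_of_weakDiv_eq_zero (hL : ContDiff ℝ 2 L) {Λ lam : ℝ} (hΛ : 0 < Λ)
    (hlam : 0 < lam) (hU : HessianLE L Λ) (hG : HessianGE L lam) {v : Eu n → ℝ}
    {g : Eu n → Eu n} (hv : MemLp v 2) (hg : MemLp g 2)
    (hvg : ∀ i, HasWeakDeriv v (fun x => g x i) (EuclideanSpace.single i 1)) {O : Set (Eu n)}
    (hO : IsOpen O)
    (hdiv : ∀ w : Eu n → ℝ, ContDiff ℝ (⊤ : ℕ∞) w → HasCompactSupport w → tsupport w ⊆ O →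
      ∫ x, inner ℝ (∇ L (g x)) (∇ w x) = 0)
    {η : Eu n → ℝ} (hη : ContDiff ℝ (⊤ : ℕ∞) η) (hηc : HasCompactSupport η)
    (hηO : tsupport η ⊆ O) (hη1 : ∀ x ∈ (V : Set (Eu n)), η x = 1) (i k : Fin n) :
    ∃ f : Eu n → ℝ, MemLp f 2 ∧ ∀ φ : 𝓓(V, ℝ),
      ∫ x, fderiv ℝ φ x (EuclideanSpace.single k 1) * g x i = - ∫ x, φ x * f x := by
  obtain ⟨δ, hδ, hδO⟩ :=
    (show IsCompact (tsupport η) from hηc).exists_thickening_subset_open hO hηO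
  obtain ⟨M, hM⟩ := hη.continuous_gradient.bounded_above_of_compact_support hηc.gradient
  have hM0 : 0 ≤ M := (norm_nonneg _).trans (hM 0)
  refine exists_weakDeriv_of_translate_le (memLp_coord hg i) (EuclideanSpace.single k 1) V
    (C := 2 * Λ * M / lam * (eLpNorm (fun x => g x k) 2).toReal) (δ := δ / 2)
    (by positivity) (by positivity) fun t ht φ => ?_
  have hP := eLpNorm_smul_translate_sub_le hL hΛ hlam hU hG hv hg hvg hdiv hη hηc hδ hδO hM k ht
  set e : Eu n := EuclideanSpace.single k 1 with he
  have hmp := measurePreserving_add_right (volume : Measure (Eu n)) (t • e)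
  have hηP : MemLp (fun x => η x • (g (x + t • e) - g x)) 2 :=
    memLp_smul_of_tsupport_subset (U := ⊤) (((hg.comp_measurePreserving hmp).sub hg).restrict _)
      hη.continuous hηc (by simp)
  have hφL : MemLp φ 2 (volume : Measure (Eu n)) :=
    φ.continuous.memLp_of_hasCompactSupport φ.hasCompactSupport
  have h1 := abs_integral_mul_le hφL (memLp_coord hηP i)
  -- `η = 1` on `V`, which contains the support of `φ`, so `η` can be inserted for free.
  have h2 : ∀ x, φ x * (η x • (g (x + t • e) - g x)) i = φ x * (g (x + t • e) i - g x i) :=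
    fun x => by
      by_cases hx : x ∈ (V : Set (Eu n))
      · rw [hη1 x hx, one_smul, PiLp.sub_apply]
      · rw [image_eq_zero_of_notMem_tsupport fun h => hx (φ.tsupport_subset h), zero_mul, zero_mul]
  have h3 : (eLpNorm (fun x => (η x • (g (x + t • e) - g x)) i) 2).toReal ≤
      (eLpNorm (fun x => η x • (g (x + t • e) - g x)) 2).toReal :=
    ENNReal.toReal_mono hηP.2.ne (eLpNorm_mono fun x => PiLp.norm_apply_le _ i)
  simp_rw [h2] at h1
  refine h1.trans ((mul_le_mul_of_nonneg_left (h3.trans hP) ENNReal.toReal_nonneg).trans_eq ?_)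
  exact mul_comm _ _

theorem IsWeakSolEL.memH1_partial (hL : ContDiff ℝ 2 L) {Λ lam : ℝ} (hΛ : 0 < Λ)
    (hlam : 0 < lam) (hU : HessianLE L Λ) (hG : HessianGE L lam) {u : Eu n → ℝ}
    (hu : IsWeakSolEL U L u) (hVc : IsCompact (closure (V : Set (Eu n))))
    (hVU : closure (V : Set (Eu n)) ⊆ U) (i : Fin n) : MemH1 V (fun x => weakGrad U u x i) := by
  have huG := hu.memH1.isWeakGrad
  have hGL : MemLp (weakGrad U u) 2 (volume.restrict U) := hu.memH1.memLp_weakGrad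
  set G := weakGrad U u with hGdef
  have hVU' : (V : Set (Eu n)) ⊆ U := subset_closure.trans hVU
  obtain ⟨η, hη, hηc, hηU, hη1⟩ := exists_cutoff hVc U.isOpen hVU
  -- Nested cutoffs: `χ = 1` near the support of `η`, so the global function `χ u` has gradient
  -- `∇u`, and solves the equation, on a neighbourhood `O` of that support.
  obtain ⟨χ, hχ, hχc, hχU, hχ1⟩ := exists_cutoff hηc U.isOpen hηU
  set v : Eu n → ℝ := fun x => χ x * u x with hvdef
  set g : Eu n → Eu n := fun x => χ x • G x + u x • ∇ χ x with hgdef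
  have hv : MemLp v 2 := memLp_smul_of_tsupport_subset hu.memH1.memLp hχ.continuous hχc hχU
  have hg : MemLp g 2 :=
    (memLp_smul_of_tsupport_subset hGL hχ.continuous hχc hχU).add
      (memLp_smul_of_tsupport_subset' hu.memH1.memLp hχ.continuous_gradient hχc.gradient
        ((tsupport_gradient_subset χ).trans hχU))
  have hvg : ∀ i, HasWeakDeriv v (fun x => g x i) (EuclideanSpace.single i 1) := fun i =>
    huG.hasWeakDeriv_cutoff hχ hχc hχU i
  obtain ⟨O, hO, hKO, hO1⟩ := mem_nhdsSet_iff_exists.1 hχ1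
  have hgG : ∀ x ∈ O, g x = G x := fun x hx => by
    have h1 : ∀ᶠ y in 𝓝 x, χ y = 1 := mem_of_superset (hO.mem_nhds hx) hO1
    simp [hgdef, h1.self_of_nhds, gradient_eq_zero_of_eventually_one h1]
  have hOU : O ⊆ U := fun x hx => hχU (subset_tsupport χ (by
    rw [Function.mem_support, hO1 hx]
    exact one_ne_zero))
  have hdiv : ∀ w : Eu n → ℝ, ContDiff ℝ (⊤ : ℕ∞) w → HasCompactSupport w → tsupport w ⊆ O →
      ∫ x, inner ℝ (∇ L (g x)) (∇ w x) = 0 := by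
    intro w hw hwc hwO
    have h1 := hu.weak.integral_eq_zero ⟨w, hw, hwc, hwO.trans hOU⟩
    rw [TestFunction.coe_mk, setIntegral_eq_of_tsupport_subset (φ := ∇ w)
      ((tsupport_gradient_subset w).trans (hwO.trans hOU)) (fun x hx => by rw [hx]; simp)] at h1
    rw [← h1]
    congr 1
    ext x
    by_cases hx : x ∈ O
    · rw [hgG x hx]
    · have : ∇ w x = 0 := image_eq_zero_of_notMem_tsupport fun h =>
        hx (hwO (tsupport_gradient_subset w h))
      rw [this, inner_zero_right, inner_zero_right]
  have hηone : ∀ x ∈ (V : Set (Eu n)), η x = 1 := fun x hx =>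
    ((eventually_nhdsSet_iff_forall.1 hη1) x (subset_closure hx)).self_of_nhds
  have hVO : (V : Set (Eu n)) ⊆ O := fun x hx => hKO (subset_tsupport η (by
    rw [Function.mem_support, hηone x hx]
    exact one_ne_zero))
  have hex : ∀ k : Fin n, ∃ f : Eu n → ℝ, MemLp f 2 ∧ ∀ φ : 𝓓(V, ℝ),
      ∫ x, fderiv ℝ φ x (EuclideanSpace.single k 1) * g x i = - ∫ x, φ x * f x := fun k =>
    exists_weakDeriv_of_weakDiv_eq_zero hL hΛ hlam hU hG hv hg hvg hO hdiv hη hηc hKO hηone i k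
  choose f hf hfφ using hex
  let H : Eu n → Eu n := fun x => ∑ k, f k x • (EuclideanSpace.single k 1 : Eu n)
  have hHk : ∀ x k, H x k = f k x := fun x k => by
    simp [H, Pi.single_apply]
  have hHL : MemLp H 2 := memLp_finsetSum _ fun k _ =>
    (hf k).of_le_mul (c := 1) ((hf k).1.smul aestronglyMeasurable_const)
      (ae_of_all _ fun x => by simp [norm_smul])
  refine ⟨memLp_coord (hGL.mono_measure (Measure.restrict_mono_set _ hVU')) i, H, ?_, hHL.restrict _⟩
  refine isWeakGrad_of_integral_fderiv_mul
    (locallyIntegrableOn_coord (huG.locInt_grad.mono_set hVU') i)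
    ((hHL.locallyIntegrable (by norm_num)).locallyIntegrableOn _) fun φ k => ?_
  simp_rw [hHk]
  rw [← hfφ k φ]
  congr 1
  ext x
  by_cases hx : x ∈ (V : Set (Eu n))
  · rw [hgG x (hVO hx)]
  · rw [image_eq_zero_of_notMem_tsupport (f := fun x => fderiv ℝ φ x (EuclideanSpace.single k 1))
      fun h => hx (φ.tsupport_subset (tsupport_fderiv_apply_subset _ _ h)), zero_mul, zero_mul]

theorem IsWeakSolEL.isWeakSolLinear_partial (hL : ContDiff ℝ 2 L) {Λ : ℝ} (hΛ : 0 < Λ)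
    (hU : HessianLE L Λ) (hG0 : HessianGE L 0) {u : Eu n → ℝ} (hu : IsWeakSolEL U L u)
    (hVU : V ≤ U) (hH1 : ∀ i, MemH1 V (fun x => weakGrad U u x i)) (i : Fin n) :
    IsWeakSolLinear V (fun x => hessian L (weakGrad U u x)) (fun x => weakGrad U u x i) := by
  have huG := hu.memH1.isWeakGrad
  have hGL : MemLp (weakGrad U u) 2 (volume.restrict U) := hu.memH1.memLp_weakGrad
  set G := weakGrad U u with hGdef
  have hGV : MemLp G 2 (volume.restrict V) := hGL.mono_measure (Measure.restrict_mono_set _ hVU)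
  set H : Fin n → Eu n → Eu n := fun j => weakGrad V (fun x => G x j) with hHdef
  have hH : ∀ j, IsWeakGrad V (fun x => G x j) (H j) := fun j => (hH1 j).isWeakGrad
  have hHL : ∀ j, MemLp (H j) 2 (volume.restrict V) := fun j => (hH1 j).memLp_weakGrad
  have hcomm := fun j => (huG.mono hVU).partial_comm hH i j
  have hbd := norm_hessian_le hL hΛ hU hG0
  refine ⟨hH1 i, ?_, fun w => ?_⟩
  · exact locallyIntegrableOn_of_locallyIntegrable_restrict
      ((memLp_clm_apply (continuous_hessian hL) hbd hGV.1 (hHL i)).locallyIntegrable (by norm_num))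
  have hw : ContDiff ℝ (⊤ : ℕ∞) w := w.contDiff
  have hwc : HasCompactSupport w := w.hasCompactSupport
  obtain ⟨χ, hχ, hχc, hχV, hχ1⟩ := exists_cutoff hwc V.isOpen w.tsupport_subset
  set e : Eu n := EuclideanSpace.single i 1 with he
  set γ : Eu n → Eu n := fun x => χ x • G x with hγdef
  set κ : Eu n → Eu n := fun x => χ x • H i x + fderiv ℝ χ x e • G x with hκdef
  have hγ : MemLp γ 2 := memLp_smul_of_tsupport_subset hGV hχ.continuous hχc hχV
  have hκ : MemLp κ 2 := (memLp_smul_of_tsupport_subset (hHL i) hχ.continuous hχc hχV).add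
    (memLp_smul_of_tsupport_subset hGV (hχ.fderiv_apply_const e).continuous
      (hχc.fderiv_apply ℝ e) ((tsupport_fderiv_apply_subset χ e).trans hχV))
  -- The `m`-th component gives `∂ᵢ(∂ₘu)`, whereas `κ` contains `∂ₘ(∂ᵢu)`; hence the use of `hcomm`.
  have hγκ : HasWeakDeriv γ κ e := by
    refine hasWeakDeriv_of_coord (hγ.locallyIntegrable (by norm_num))
      (hκ.locallyIntegrable (by norm_num)) fun m => ?_
    refine ((hH m).hasWeakDeriv_cutoff hχ hχc hχV i).congr (ae_of_all _ fun x => rfl) ?_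
    have h1 := (ae_restrict_iff' V.isOpen.measurableSet).1 (hcomm m)
    filter_upwards [h1] with x hx
    simp only [hκdef, PiLp.add_apply, PiLp.smul_apply, gradient_apply, smul_eq_mul]
    by_cases hxV : x ∈ (V : Set (Eu n))
    · rw [hx hxV]
      ring
    · rw [image_eq_zero_of_notMem_tsupport fun h => hxV (hχV h)]
      ring
  have hchain : ∀ m, HasWeakDeriv (fun x => (∇ L (γ x)) m)
      (fun x => (hessian L (γ x) (κ x)) m) e := fun m => by
    have hΦd : ∀ p, HasFDerivAt (fun p => (∇ L p) m)
        ((EuclideanSpace.proj (𝕜 := ℝ) m).comp (hessian L p)) p := fun p =>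
      (EuclideanSpace.proj (𝕜 := ℝ) m).hasFDerivAt.comp p (hasFDerivAt_gradient hL p)
    have h1 := HasWeakDeriv.comp (Φ := fun p => (∇ L p) m)
      ((EuclideanSpace.proj (𝕜 := ℝ) m).contDiff.comp (contDiff_gradient hL))
      (M := ‖(EuclideanSpace.proj m : Eu n →L[ℝ] ℝ)‖ * Λ) (fun p => by
        rw [(hΦd p).fderiv]
        exact (opNorm_comp_le _ _).trans (mul_le_mul_of_nonneg_left (hbd p) (norm_nonneg _)))
      hγ hκ hγκ
    simp_rw [(hΦd _).fderiv] at h1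
    exact h1
  have hkey := integral_inner_fderiv_eq_neg
    (locallyIntegrable_gradient_comp hL hΛ hU hG0 hγ)
    ((memLp_clm_apply (continuous_hessian hL) hbd hγ.1 hκ).locallyIntegrable (by norm_num))
    hchain (W := ∇ w) ((InnerProductSpace.toDual ℝ (Eu n)).symm.contDiff.comp
      (hw.fderiv_right (m := (⊤ : ℕ∞)) (by simp))) hwc.gradient
  have hone : ∀ x ∈ tsupport w, ∀ᶠ y in 𝓝 x, χ y = 1 := fun x hx =>
    (eventually_nhdsSet_iff_forall.1 hχ1) x hx
  have hγG : ∀ x ∈ tsupport w, γ x = G x := fun x hx => by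
    simp [hγdef, (hone x hx).self_of_nhds]
  have hκH : ∀ x ∈ tsupport w, κ x = H i x := fun x hx => by
    have h1 := gradient_eq_zero_of_eventually_one (hone x hx)
    have h2 : fderiv ℝ χ x e = 0 := by rw [← gradient_apply, h1]; rfl
    simp [hκdef, (hone x hx).self_of_nhds, h2]
  -- The nonlinear equation tested with `∂ᵢw`, since `∂ᵢ∇w = ∇∂ᵢw`.
  have hL0 : ∫ x, inner ℝ (∇ L (γ x)) (fderiv ℝ (∇ w) x e) = 0 := by
    let w' : 𝓓(U, ℝ) := ⟨partialTest w i, (partialTest w i).contDiff,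
      (partialTest w i).hasCompactSupport, (partialTest w i).tsupport_subset.trans hVU⟩
    have h1 := hu.weak.integral_eq_zero w'
    rw [setIntegral_eq_of_tsupport_subset (φ := ∇ w')
      ((tsupport_gradient_subset w').trans w'.tsupport_subset)
      (fun x hx => by rw [hx]; simp)] at h1
    rw [← h1]
    congr 1
    ext x
    have h2 : fderiv ℝ (∇ w) x e = ∇ w' x := hessian_apply_single_apply hw x i
    rw [h2]
    by_cases hx : x ∈ tsupport w
    · rw [hγG x hx]
    · have h3 : ∇ w' x = 0 := image_eq_zero_of_notMem_tsupport fun h =>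
        hx (tsupport_fderiv_apply_subset w e (tsupport_gradient_subset w' h))
      rw [h3, inner_zero_right, inner_zero_right]
  rw [hL0, zero_eq_neg] at hkey
  rw [setIntegral_eq_of_tsupport_subset (φ := ∇ w)
    ((tsupport_gradient_subset w).trans w.tsupport_subset) (fun x hx => by rw [hx]; simp), ← hkey]
  congr 1
  ext x
  by_cases hx : x ∈ tsupport w
  · rw [hγG x hx, hκH x hx]
  · have h3 : ∇ w x = 0 := image_eq_zero_of_notMem_tsupport fun h =>
      hx (tsupport_gradient_subset w h)
    rw [h3, inner_zero_right, inner_zero_right]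

/-- `weakGrad` is a choice made separately on each open set, so `weakGrad V u` and `weakGrad U u`
are only known to agree a.e. on `V`; membership in `H¹` does not see the difference. -/
theorem IsWeakSolEL.memH2 {u : Eu n → ℝ} (hu : IsWeakSolEL U L u) (hVU : V ≤ U)
    (hH1 : ∀ i, MemH1 V (fun x => weakGrad U u x i)) : MemH2 V u := by
  have hmono := Measure.restrict_mono_set (volume : Measure (Eu n)) hVU
  have hG := hu.memH1.isWeakGrad.mono hVU
  refine ⟨⟨hu.memH1.memLp.mono_measure hmono, _, hG,
    hu.memH1.memLp_weakGrad.mono_measure hmono⟩, fun i => (hH1 i).congr ?_⟩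
  exact hG.weakGrad_ae_eq.mono fun x hx => by simp only [hx]

end Regularity

end EllipticReg

theorem lemma2p1 {n : ℕ} (U : Opens (EllipticReg.Eu n)) (L : EllipticReg.Eu n → ℝ)
    (hL : ContDiff ℝ 2 L) (Λ : ℝ) (hΛ : 0 < Λ) (hupper : EllipticReg.HessianLE L Λ) :
    -- (i)
    (∀ 𝒜 : Set (EllipticReg.Eu n → ℝ), EllipticReg.IsAdmissibleClass U 𝒜 →
      ∀ u : EllipticReg.Eu n → ℝ, EllipticReg.IsMinimiser U L 𝒜 u →
        EllipticReg.IsWeakSolEL U L u) ∧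
    -- (ii)
    (EllipticReg.HessianGE L Λ⁻¹ →
      ∀ u : EllipticReg.Eu n → ℝ, EllipticReg.IsWeakSolEL U L u →
      ∀ V : Opens (EllipticReg.Eu n),
        IsCompact (closure (V : Set (EllipticReg.Eu n))) →
        closure (V : Set (EllipticReg.Eu n)) ⊆ U →
        EllipticReg.MemH2 V u ∧
        ∀ i : Fin n, EllipticReg.IsWeakSolLinear V
          (fun x => EllipticReg.hessian L (EllipticReg.weakGrad U u x))
          (fun x => EllipticReg.weakGrad U u x i)) := by
  refine ⟨fun 𝒜 h𝒜 u hu => hu.isWeakSolEL hL hΛ hupper h𝒜, fun hG u hu V hVc hVU => ?_⟩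
  have hH1 := fun i => hu.memH1_partial hL hΛ (inv_pos.2 hΛ) hupper hG hVc hVU i
  have hVU' : V ≤ U := subset_closure.trans hVU
  exact ⟨hu.memH2 hVU' hH1, fun i =>
    hu.isWeakSolLinear_partial hL hΛ hupper (hG.mono (inv_pos.2 hΛ).le) hVU' hH1 i⟩
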